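/- Let $\mathbb K=\mathbb R$ or $\mathbb C$, let $n\ge 1$, and let $f:\mathbb K^n\to\mathbb K$ be a polynomial function of positive degree $d$, with leading form $f_d$ (its homogeneous part of degree $d$). Assume that $f_d$ is generic, in the sense that it is irreducible in $\mathbb K[x_1,\dots,x_n]$ and every critical point of $f_d$ at which $f_d$ vanishes is the origin: $f_d^{-1}(0)\cap\operatorname{crit}(f_d)\subset\{0\}$. Let $c\in\mathbb K$ be such that the level $f^{-1}(c)$ is non-empty and regular, that is, contains no critical point of $f$. Then $f^{-1}(c)$ is conic at infinity, and each of its connected components is Lipschitz normally embedded (LNE). If $\mathbb K=\mathbb C$, then for every $c\in\mathbb C$ the level $f^{-1}(c)$ is an irreducible algebraic set: it is non-empty and is not the union of two proper algebraic subsets. Here $\mathbb K^n$ is regarded as the Euclidean space $\mathbb R^N$, with $N=n$ or $N=2n$. A subset $S$ is LNE if there is a constant $L>0$ such that any $x,y\in S$ satisfy $d_{\rm inn}^S(x,y)\le L|x-y|$, where $d_{\rm inn}^S(x,y)\in[0,\infty]$ is the infimum of the lengths of the rectifiable paths in $S$ joining $x$ and $y$. Compactify $\mathbb R^N$ by a sphere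 at infinity, using the chart $M=[0,\infty)\times\mathbb S^{N-1}$ in which $(r,u)$ with $r>0$ represents the point $u/r$, and in which $\partial M=\{0\}\times\mathbb S^{N-1}$ is the sphere at infinity. A subset $X$ of $\mathbb R^N$ is conic at infinity if it is bounded, or if its closure $\overline X$ in this compactification meets $\partial M$ and is, near each point of $\overline X\cap\partial M$, a smooth p-sub-manifold of $M$: a smooth sub-manifold $N_0$ with boundary $\partial N_0=N_0\cap\partial M$, such that $T_pN_0+T_p\partial M=T_pM$ for every $p\in\partial N_0$. -/

import Mathlib

open scoped ContDiff

noncomputable section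

namespace ConicLNE

/-! ### Inner distance and Lipschitz normal embedding -/

section Metric

variable {E : Type*} [NormedAddCommGroup E]

/-- The inner distance of `S`: the infimum of the lengths of the paths lying in `S` that join
`x` to `y`. It is `∞` if no rectifiable path in `S` joins the two points. -/
def innerDist (S : Set E) (x y : E) : ENNReal :=
  ⨅ (γ : Path x y) (_ : ∀ t, γ t ∈ S), eVariationOn γ Set.univ

/-- `S` is Lipschitz normally embedded: the inner distance is bounded by a constant times the
outer distance. -/
def IsLNE (S : Set E) : Prop :=
  ∃ L : ℝ, 0 < L ∧ ∀ x ∈ S, ∀ y ∈ S, innerDist S x y ≤ ENNReal.ofReal L * edist x y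

end Metric

/-! ### Sub-manifolds with boundary and p-sub-manifolds -/

section Submanifold

/-- `Φ` is a smooth chart of the vector space `F`, centred at `p`, which exhibits `N` near `p` as
a smooth sub-manifold with boundary, with `p` on the boundary: within the domain of `Φ`, the set
`N` is the preimage of the half-space `{0 ≤ ℓ}` of the linear subspace `V`
(and `∂N` is the preimage of `V ∩ {ℓ = 0}`). -/
structure IsBoundaryChart {F : Type*} [NormedAddCommGroup F] [NormedSpace ℝ F]
    (N : Set F) (p : F) (Φ : OpenPartialHomeomorph F F) (V : Submodule ℝ F)
    (ℓ : F →L[ℝ] ℝ) : Prop where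
  mem_source : p ∈ Φ.source
  map_center : Φ p = 0
  smooth : ContDiffOn ℝ ∞ Φ Φ.source
  smooth_symm : ContDiffOn ℝ ∞ Φ.symm Φ.target
  nontrivial : ∃ v ∈ V, ℓ v ≠ 0
  mem_iff : ∀ x ∈ Φ.source, (x ∈ N ↔ Φ x ∈ V ∧ 0 ≤ ℓ (Φ x))

variable {E : Type*} [NormedAddCommGroup E] [NormedSpace ℝ E]

/-- The tangent space at `u` of the unit sphere of `E` (where `E` carries a Euclidean norm), that
is, the kernel of the derivative of `‖·‖ ^ 2` at `u`. -/
def sphereTangent (u : E) : Submodule ℝ E :=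
  LinearMap.ker (fderiv ℝ (fun v : E => ‖v‖ ^ 2) u).toLinearMap

/-- For a subset `N` of the manifold with boundary `M = [0, ∞) × 𝕊`, where `𝕊` is the unit sphere
of `E` and `∂M = {0} × 𝕊`: the germ of `N` at the point `(0, u)` of `N ∩ ∂M` is that of a smooth
p-sub-manifold of `M`. That is, near `(0, u)`, `N` is a smooth sub-manifold with boundary, its
boundary is `N ∩ ∂M`, and at `p = (0, u)` it is transverse to `∂M`: `T_p N + T_p ∂M = T_p M`. -/
def IsPSubmanifoldAt (N : Set (ℝ × E)) (u : E) : Prop :=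
  ∃ (Φ : OpenPartialHomeomorph (ℝ × E) (ℝ × E)) (V : Submodule ℝ (ℝ × E))
    (ℓ : (ℝ × E) →L[ℝ] ℝ),
    IsBoundaryChart N (0, u) Φ V ℓ ∧
    (∀ x ∈ Φ.source, x ∈ N → (ℓ (Φ x) = 0 ↔ x.1 = 0)) ∧
    V.comap (fderiv ℝ Φ (0, u)).toLinearMap ⊔ (⊥ : Submodule ℝ ℝ).prod (sphereTangent u)
      = (⊤ : Submodule ℝ ℝ).prod (sphereTangent u)

/-! ### The sphere at infinity -/

/-- The closure of `X` in the spherical compactification of `E`, read in the chart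
`[0, ∞) × 𝕊` at infinity, in which `(r, u)` with `0 < r` is the point `u / r` of `E` and
`{0} × 𝕊` is the sphere at infinity. -/
def closureAtInfinity (X : Set E) : Set (ℝ × E) :=
  closure {q : ℝ × E | 0 < q.1 ∧ ‖q.2‖ = 1 ∧ q.1⁻¹ • q.2 ∈ X}

/-- The asymptotic set of `X` at infinity, a subset of the unit sphere. -/
def asymptoticSet (X : Set E) : Set E :=
  {u | ((0 : ℝ), u) ∈ closureAtInfinity X}

/-- `X` is conic at infinity: it is bounded, or its closure is, near the (non-empty) asymptotic
set, a smooth p-sub-manifold of the spherical compactification. -/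
def IsConicAtInfinity (X : Set E) : Prop :=
  Bornology.IsBounded X ∨
    ((asymptoticSet X).Nonempty ∧
      ∀ u ∈ asymptoticSet X, IsPSubmanifoldAt (closureAtInfinity X) u)

end Submanifold

/-! ### Polynomials and algebraic sets -/

section Polynomials

variable {𝕜 : Type*} [RCLike 𝕜] {n : ℕ}

/-- The leading form of `f`: its homogeneous component of highest degree. -/
def leadingForm (f : MvPolynomial (Fin n) 𝕜) : MvPolynomial (Fin n) 𝕜 :=
  MvPolynomial.homogeneousComponent f.totalDegree f

/-- The level `f⁻¹(c)` in `𝕜ⁿ` with its Euclidean metric. -/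
def level (f : MvPolynomial (Fin n) 𝕜) (c : 𝕜) : Set (EuclideanSpace 𝕜 (Fin n)) :=
  {x | MvPolynomial.eval (fun i => x i) f = c}

/-- The critical locus of `f`. -/
def critLocus (f : MvPolynomial (Fin n) 𝕜) : Set (EuclideanSpace 𝕜 (Fin n)) :=
  {x | ∀ i, MvPolynomial.eval (fun j => x j) (MvPolynomial.pderiv i f) = 0}

/-- The form `g` is generic: irreducible, and its only possible critical zero is the origin. -/
def IsGenericForm (g : MvPolynomial (Fin n) 𝕜) : Prop :=
  Irreducible g ∧ level g 0 ∩ critLocus g ⊆ {0}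

/-- `Z` is the common zero set in `𝕜ⁿ` of a set of polynomials. -/
def IsAlgebraicSet (Z : Set (EuclideanSpace 𝕜 (Fin n))) : Prop :=
  ∃ S : Set (MvPolynomial (Fin n) 𝕜),
    Z = {x | ∀ p ∈ S, MvPolynomial.eval (fun i => x i) p = 0}

/-- `Z` is an irreducible algebraic set: non-empty, and not the union of two proper algebraic
subsets. -/
def IsIrreducibleAlgebraicSet (Z : Set (EuclideanSpace 𝕜 (Fin n))) : Prop :=
  IsAlgebraicSet Z ∧ Z.Nonempty ∧
    ∀ Z₁ Z₂ : Set (EuclideanSpace 𝕜 (Fin n)), IsAlgebraicSet Z₁ → IsAlgebraicSet Z₂ →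
      Z = Z₁ ∪ Z₂ → Z = Z₁ ∨ Z = Z₂

end Polynomials

end ConicLNE

end

/-! Write `d` for the degree and homogenize with a real variable: `H(r, u) = r ^ d * (f (u / r) -
c)` is polynomial in `(r, u)` and restricts to the leading form at `r = 0`. In the chart at infinity
the level is cut out by `H = 0`, `‖u‖ ^ 2 = 1`. At a zero with `r = 0`, genericity makes the
derivative of the leading form in `u` surjective, while Euler's identity says that it kills the
radial direction, along which the norm varies. Hence the pair of equations is submersive in `u`
alone (`isEquationAtInfinity_level`).

The inverse function theorem, in a form that keeps the coordinate `r` (`exists_levelChart`),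
straightens the zero set to `r` times a linear space. This gives the p-sub-manifold, transverse to
`r = 0`. The same chart joins nearby zeros by Lipschitz rectangles; scaled back by `1 / r`, their
sides are paths in the level of length comparable to the Euclidean distance
(`IsEquationAtInfinity.isLNENear`). Regularity of the level gives the analogous estimate at finite
points, and compactness of the closed ball, a radial compactification of the space, turns local
estimates into a global one on a connected component (`isLNE_of_isLNENear`).

For irreducibility, leading forms are multiplicative, so `f - c` is irreducible because its leading
form is; over `ℂ` the Nullstellensatz passes this to the zero set. -/

namespace ConicLNE

open Set Filter Topology Metric
open scoped NNReal ENNReal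

/-! ### Inner distance: Lipschitz paths, triangle inequality, components -/

section InnerDistance

variable {E : Type*} [NormedAddCommGroup E]

theorem eVariationOn_coe_unitInterval_le : eVariationOn ((↑) : unitInterval → ℝ) univ ≤ 1 := by
  have h : MonotoneOn ((↑) : unitInterval → ℝ) univ := fun _ _ _ _ h => h
  have := (h.eVariationOn_eq (mem_univ 0) (mem_univ 1)).le
  have h2 : (univ : Set unitInterval) ∩ Icc 0 1 = univ := by
    ext t; simp [unitInterval.le_one']
  simpa [h2] using this

theorem innerDist_le_of_lipschitzOnWith {S : Set E} {x y : E} {g : ℝ → E} {K : ℝ≥0} {a b : ℝ}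
    (hab : a ≤ b) (hg : LipschitzOnWith K g (Icc a b)) (ha : g a = x) (hb : g b = y)
    (hS : ∀ t ∈ Icc a b, g t ∈ S) :
    innerDist S x y ≤ ENNReal.ofReal (K * (b - a)) := by
  have hmaps : MapsTo (fun t : unitInterval => a + (t : ℝ) * (b - a)) univ (Icc a b) := by
    intro t _
    have h0 := t.2.1
    have h1 := t.2.2
    constructor
    · nlinarith
    · nlinarith
  let γ : Path x y :=
    { toFun := fun t => g (a + (t : ℝ) * (b - a))
      continuous_toFun := by
        have := hg.continuousOn.comp_continuous
          (f := fun t : unitInterval => a + (t : ℝ) * (b - a)) (by fun_prop)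
          (fun t => hmaps (mem_univ t))
        exact this
      source' := by simp [ha]
      target' := by simp [hb] }
  have hγ : eVariationOn γ univ ≤ ENNReal.ofReal (K * (b - a)) := by
    have hba : 0 ≤ b - a := sub_nonneg.2 hab
    have h1 : LipschitzOnWith (b - a).toNNReal (fun t : ℝ => a + t * (b - a)) univ := by
      refine LipschitzOnWith.of_dist_le_mul fun s _ t _ => ?_
      rw [Real.coe_toNNReal _ hba, Real.dist_eq, Real.dist_eq]
      rw [show a + s * (b - a) - (a + t * (b - a)) = (b - a) * (s - t) by ring, abs_mul,
        abs_of_nonneg hba]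
    have h2 := hg.comp_eVariationOn_le hmaps
    have h3 := h1.comp_eVariationOn_le (mapsTo_univ ((↑) : unitInterval → ℝ) univ)
    calc eVariationOn γ univ ≤ K * ((b - a).toNNReal * 1) :=
          h2.trans (mul_le_mul_right (h3.trans (mul_le_mul_right
            eVariationOn_coe_unitInterval_le _)) _)
      _ = ENNReal.ofReal (K * (b - a)) := by
          rw [mul_one, ENNReal.ofReal_mul (p := (K : ℝ)) K.2, ENNReal.ofReal_coe_nnreal]
          rfl
  exact (iInf₂_le γ fun t => hS _ (hmaps (mem_univ t))).trans hγ

theorem innerDist_comm (S : Set E) (x y : E) : innerDist S x y = innerDist S y x := by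
  have key : ∀ x y : E, innerDist S x y ≤ innerDist S y x := by
    intro x y
    refine le_iInf₂ fun γ hγ => (iInf₂_le γ.symm fun t => ?_).trans ?_
    · exact hγ _
    · exact eVariationOn.comp_le_of_antitoneOn γ unitInterval.symm
        (fun a _ b _ h => unitInterval.symm_le_symm.2 h) (mapsTo_univ _ _)
  exact le_antisymm (key x y) (key y x)

theorem eVariationOn_path_trans_le {x y z : E} (γ : Path x y) (γ' : Path y z) :
    eVariationOn (γ.trans γ') univ ≤ eVariationOn γ univ + eVariationOn γ' univ := by
  -- Split at the midpoint; on each half the concatenation is a monotone reparametrization of one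
  -- path, made total by `projIcc`.
  let m : unitInterval := ⟨1 / 2, by norm_num, by norm_num⟩
  have h := eVariationOn.union (γ.trans γ') (s := Iic m) (t := Ici m) isGreatest_Iic isLeast_Ici
  rw [Iic_union_Ici] at h
  rw [h]
  refine add_le_add ?_ ?_
  · have : EqOn (γ.trans γ') (γ ∘ fun t => projIcc (0 : ℝ) 1 zero_le_one (2 * t)) (Iic m) := by
      intro t ht
      have ht' : (t : ℝ) ≤ 1 / 2 := ht
      have h0 := t.2.1
      simp only [Path.trans_apply, dif_pos ht', Function.comp_apply]
      rw [projIcc_of_mem]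
    rw [eVariationOn.congr this]
    refine eVariationOn.comp_le_of_monotoneOn γ _ (fun a _ b _ hab => monotone_projIcc _ ?_)
      (mapsTo_univ _ _)
    have : (a : ℝ) ≤ b := hab
    linarith
  · have : EqOn (γ.trans γ') (γ' ∘ fun t => projIcc (0 : ℝ) 1 zero_le_one (2 * t - 1))
        (Ici m) := by
      intro t ht
      have ht' : 1 / 2 ≤ (t : ℝ) := ht
      have h1 := t.2.2
      rcases ht'.eq_or_lt with h | h
      · have : t = m := Subtype.ext h.symm
        simp [Path.trans_apply, this, m]
      · simp only [Path.trans_apply, dif_neg h.not_ge, Function.comp_apply]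
        rw [projIcc_of_mem]
    rw [eVariationOn.congr this]
    refine eVariationOn.comp_le_of_monotoneOn γ' _ (fun a _ b _ hab => monotone_projIcc _ ?_)
      (mapsTo_univ _ _)
    have : (a : ℝ) ≤ b := hab
    linarith

theorem innerDist_triangle (S : Set E) (x y z : E) :
    innerDist S x z ≤ innerDist S x y + innerDist S y z := by
  simp only [innerDist, ENNReal.iInf_add, ENNReal.add_iInf]
  refine le_iInf₂ fun γ' hγ' => le_iInf₂ fun γ hγ => ?_
  refine (iInf₂_le (γ.trans γ') fun t => ?_).trans (eVariationOn_path_trans_le γ γ')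
  rw [Path.trans_apply]
  split_ifs
  · exact hγ _
  · exact hγ' _

/-- The range of a path is connected, so a path in `X` that starts in a component never leaves it.
-/
theorem innerDist_connectedComponentIn_le {X : Set E} {x₀ x y : E}
    (hx : x ∈ connectedComponentIn X x₀) :
    innerDist (connectedComponentIn X x₀) x y ≤ innerDist X x y := by
  refine le_iInf₂ fun γ hγ => iInf₂_le γ fun t => ?_
  rw [connectedComponentIn_eq hx]
  exact (isPreconnected_range γ.continuous).subset_connectedComponentIn ⟨0, γ.source⟩
    (range_subset_iff.2 hγ) ⟨t, rfl⟩

end InnerDistance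

/-! ### The radial compactification by the closed unit ball -/

section Radial

variable {E : Type*} [NormedAddCommGroup E] [NormedSpace ℝ E]

/-- The radial homeomorphism of `E` onto its open unit ball. -/
noncomputable def radial (x : E) : E := (1 + ‖x‖)⁻¹ • x

theorem norm_radial (x : E) : ‖radial x‖ = ‖x‖ / (1 + ‖x‖) := by
  have : 0 < 1 + ‖x‖ := by positivity
  rw [radial, norm_smul, norm_inv, Real.norm_of_nonneg this.le, inv_mul_eq_div]

theorem norm_radial_lt_one (x : E) : ‖radial x‖ < 1 := by
  rw [norm_radial, div_lt_one (by positivity)]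
  linarith

theorem one_sub_norm_radial (x : E) : 1 - ‖radial x‖ = (1 + ‖x‖)⁻¹ := by
  have : 0 < 1 + ‖x‖ := by positivity
  rw [norm_radial]
  field_simp
  ring

theorem inv_smul_radial (x : E) : (1 - ‖radial x‖)⁻¹ • radial x = x := by
  have : 0 < 1 + ‖x‖ := by positivity
  rw [one_sub_norm_radial, inv_inv, radial, smul_inv_smul₀ this.ne']

theorem continuous_radial : Continuous (radial : E → E) := by
  unfold radial
  refine Continuous.smul (Continuous.inv₀ (by fun_prop) fun x => ?_) continuous_id
  positivity

/-- At `x` the compactification shrinks distances by at least the factor `1 + ‖x‖`, up to 2. Points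
whose images stay apart are therefore at a distance comparable to their norms. -/
theorem dist_radial_mul_le (x y : E) : dist (radial x) (radial y) * (1 + ‖x‖) ≤ 2 * dist x y := by
  have hx : 0 < 1 + ‖x‖ := by positivity
  have hy : 0 < 1 + ‖y‖ := by positivity
  have h1 : (1 + ‖x‖) • (radial x - radial y)
      = (x - y) + ((‖y‖ - ‖x‖) * (1 + ‖y‖)⁻¹) • y := by
    rw [smul_sub, radial, radial, smul_inv_smul₀ hx.ne', smul_smul, sub_add]
    congr 1
    have : (1 : ℝ) - (‖y‖ - ‖x‖) * (1 + ‖y‖)⁻¹ = (1 + ‖x‖) * (1 + ‖y‖)⁻¹ := by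
      field_simp; ring
    rw [← this, sub_smul, one_smul]
  have h2 : ‖(1 + ‖x‖) • (radial x - radial y)‖ ≤ ‖x - y‖ + ‖x - y‖ := by
    rw [h1]
    refine (norm_add_le _ _).trans (add_le_add le_rfl ?_)
    rw [norm_smul, norm_mul, norm_inv, Real.norm_of_nonneg hy.le, mul_assoc]
    have h3 : (1 + ‖y‖)⁻¹ * ‖y‖ ≤ 1 := by
      rw [inv_mul_le_one₀ hy]; linarith
    have h4 : ‖‖y‖ - ‖x‖‖ ≤ ‖x - y‖ := by
      rw [norm_sub_rev x y]; exact abs_norm_sub_norm_le y x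
    calc _ ≤ ‖x - y‖ * 1 := by gcongr
      _ = _ := mul_one _
  rw [norm_smul, Real.norm_of_nonneg hx.le] at h2
  rw [dist_eq_norm, dist_eq_norm]
  linarith

end Radial

/-! ### From local estimates on the compactification to LNE -/

section Global

variable {E : Type*} [NormedAddCommGroup E] [NormedSpace ℝ E]

/-- The set `X` is LNE near the point `α` of the radial compactification of `E`. -/
def IsLNENear (X : Set E) (α : E) : Prop :=
  ∃ S ∈ 𝓝 α, ∃ L : ℝ, 0 ≤ L ∧ ∀ x ∈ X, ∀ y ∈ X, radial x ∈ S → radial y ∈ S →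
    innerDist X x y ≤ ENNReal.ofReal (L * dist x y)

/-- Finite inner distance is an equivalence relation whose classes are open in `C`, so connectedness
leaves only one class. -/
theorem innerDist_ne_top_of_isLNENear {C : Set E} (hC : IsPreconnected C)
    (h : ∀ α ∈ closedBall (0 : E) 1, IsLNENear C α) {x y : E} (hx : x ∈ C) (hy : y ∈ C) :
    innerDist C x y ≠ ⊤ := by
  refine hC.induction₂ (fun x y => innerDist C x y ≠ ⊤) (fun x hx => ?_)
    (fun x y z _ _ _ h₁ h₂ => ?_) (fun x y _ _ h => ?_) hx hy
  · obtain ⟨S, hS, L, -, hL⟩ := h (radial x)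
      (mem_closedBall_zero_iff.2 (norm_radial_lt_one x).le)
    have hn : radial ⁻¹' S ∈ 𝓝[C] x := mem_nhdsWithin_of_mem_nhds
      (continuous_radial.continuousAt hS)
    filter_upwards [hn, self_mem_nhdsWithin] with y hyS hyC
    exact ne_top_of_le_ne_top ENNReal.ofReal_ne_top (hL x hx y hyC (mem_of_mem_nhds hS) hyS)
  · exact ne_top_of_le_ne_top (ENNReal.add_ne_top.2 ⟨h₁, h₂⟩) (innerDist_triangle _ _ _ _)
  · rwa [innerDist_comm]

theorem innerDist_le_linear_of_isLNENear [ProperSpace E] {C : Set E} (hC : IsPreconnected C)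
    (h : ∀ α ∈ closedBall (0 : E) 1, IsLNENear C α) {a : E} (ha : a ∈ C) :
    ∃ M : ℝ, 0 ≤ M ∧ ∀ x ∈ C, innerDist C x a ≤ ENNReal.ofReal (M * (1 + ‖x‖)) := by
  have key : ∃ M : ℝ, 0 ≤ M ∧ ∀ x ∈ C, radial x ∈ closedBall (0 : E) 1 →
      innerDist C x a ≤ ENNReal.ofReal (M * (1 + ‖x‖)) := by
    refine IsCompact.induction_on (p := fun T => ∃ M : ℝ, 0 ≤ M ∧ ∀ x ∈ C, radial x ∈ T →
      innerDist C x a ≤ ENNReal.ofReal (M * (1 + ‖x‖))) (isCompact_closedBall (0 : E) 1)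
      ⟨0, le_rfl, by simp⟩ ?_ ?_ ?_
    · rintro S T hST ⟨M, hM, h⟩
      exact ⟨M, hM, fun x hx hxS => h x hx (hST hxS)⟩
    · rintro S T ⟨M, hM, h⟩ ⟨M', hM', h'⟩
      refine ⟨max M M', le_max_of_le_left hM, fun x hx hxS => ?_⟩
      rcases hxS with hxS | hxS
      · exact (h x hx hxS).trans (ENNReal.ofReal_le_ofReal (by gcongr; exact le_max_left _ _))
      · exact (h' x hx hxS).trans (ENNReal.ofReal_le_ofReal (by gcongr; exact le_max_right _ _))
    · intro α hα
      obtain ⟨S, hS, L, hL0, hL⟩ := h α hα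
      refine ⟨S, mem_nhdsWithin_of_mem_nhds hS, ?_⟩
      by_cases hz : ∃ z ∈ C, radial z ∈ S
      · obtain ⟨z, hzC, hzS⟩ := hz
        have hfin := innerDist_ne_top_of_isLNENear hC h hzC ha
        refine ⟨L * (1 + ‖z‖) + (innerDist C z a).toReal, by positivity, fun x hx hxS => ?_⟩
        refine (innerDist_triangle C x z a).trans ?_
        rw [← ENNReal.ofReal_toReal (a := innerDist C z a) hfin]
        refine (add_le_add (hL x hx z hzC hxS hzS) le_rfl).trans ?_
        rw [← ENNReal.ofReal_add (by positivity) (by positivity)]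
        refine ENNReal.ofReal_le_ofReal ?_
        rw [ENNReal.toReal_ofReal ENNReal.toReal_nonneg, add_mul]
        have h1 : dist x z ≤ (1 + ‖z‖) * (1 + ‖x‖) := by
          have := dist_le_norm_add_norm x z
          nlinarith [norm_nonneg x, norm_nonneg z]
        have h2 : L * dist x z ≤ L * (1 + ‖z‖) * (1 + ‖x‖) := by
          rw [mul_assoc]; gcongr
        have h3 : (innerDist C z a).toReal ≤ (innerDist C z a).toReal * (1 + ‖x‖) :=
          le_mul_of_one_le_right ENNReal.toReal_nonneg (by linarith [norm_nonneg x])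
        exact add_le_add h2 h3
      · push Not at hz
        exact ⟨0, le_rfl, fun x hx hxS => absurd hxS (hz x hx)⟩
  obtain ⟨M, hM, hM'⟩ := key
  exact ⟨M, hM, fun x hx =>
    hM' x hx (mem_closedBall_zero_iff.2 (norm_radial_lt_one x).le)⟩

/-- A connected set which is LNE near every point of the radial compactification is LNE. -/
theorem isLNE_of_isLNENear [ProperSpace E] {C : Set E} (hC : IsPreconnected C)
    (h : ∀ α ∈ closedBall (0 : E) 1, IsLNENear C α) : IsLNE C := by
  rcases C.eq_empty_or_nonempty with rfl | ⟨a, ha⟩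
  · exact ⟨1, one_pos, by simp⟩
  obtain ⟨M, hM0, hM⟩ := innerDist_le_linear_of_isLNENear hC h ha
  have key : ∃ L : ℝ, 0 ≤ L ∧ ∀ x ∈ C, ∀ y ∈ C,
      (radial x, radial y) ∈ closedBall (0 : E) 1 ×ˢ closedBall (0 : E) 1 →
      innerDist C x y ≤ ENNReal.ofReal (L * dist x y) := by
    refine IsCompact.induction_on (p := fun T => ∃ L : ℝ, 0 ≤ L ∧ ∀ x ∈ C, ∀ y ∈ C,
      (radial x, radial y) ∈ T → innerDist C x y ≤ ENNReal.ofReal (L * dist x y))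
      ((isCompact_closedBall (0 : E) 1).prod (isCompact_closedBall (0 : E) 1))
      ⟨0, le_rfl, by simp⟩ ?_ ?_ ?_
    · rintro S T hST ⟨L, hL, h⟩
      exact ⟨L, hL, fun x hx y hy hxS => h x hx y hy (hST hxS)⟩
    · rintro S T ⟨L, hL, h⟩ ⟨L', hL', h'⟩
      refine ⟨max L L', le_max_of_le_left hL, fun x hx y hy hxS => ?_⟩
      rcases hxS with hxS | hxS
      · exact (h x hx y hy hxS).trans
          (ENNReal.ofReal_le_ofReal (by gcongr; exact le_max_left _ _))
      · exact (h' x hx y hy hxS).trans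
          (ENNReal.ofReal_le_ofReal (by gcongr; exact le_max_right _ _))
    · rintro ⟨α, β⟩ ⟨hα, -⟩
      by_cases hαβ : α = β
      · obtain ⟨S, hS, L, hL0, hL⟩ := h α hα
        subst hαβ
        exact ⟨S ×ˢ S, mem_nhdsWithin_of_mem_nhds (prod_mem_nhds hS hS), L, hL0,
          fun x hx y hy hxy => hL x hx y hy hxy.1 hxy.2⟩
      · set δ := dist α β / 2 with hδ
        have hδ0 : 0 < δ := half_pos (dist_pos.2 hαβ)
        have hT : {q : E × E | δ < dist q.1 q.2} ∈ 𝓝 (α, β) :=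
          (isOpen_lt continuous_const (by fun_prop)).mem_nhds
            (half_lt_self (dist_pos.2 hαβ))
        -- The detour costs `M * (1 + ‖x‖) + M * (1 + ‖y‖)`, and `dist_radial_mul_le` bounds each of
        -- `1 + ‖x‖`, `1 + ‖y‖` by `2 * dist x y / δ`.
        refine ⟨_, mem_nhdsWithin_of_mem_nhds hT, 4 * M / δ, by positivity,
          fun x hx y hy hxy => ?_⟩
        have hxy' : δ < dist (radial x) (radial y) := hxy
        refine (innerDist_triangle C x a y).trans ?_
        rw [innerDist_comm C a y]
        refine (add_le_add (hM x hx) (hM y hy)).trans ?_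
        rw [← ENNReal.ofReal_add (by positivity) (by positivity)]
        refine ENNReal.ofReal_le_ofReal ?_
        have h1 := dist_radial_mul_le x y
        have h2 := dist_radial_mul_le y x
        rw [dist_comm y x, dist_comm (radial y)] at h2
        have h3 : δ * (1 + ‖x‖) ≤ 2 * dist x y := le_trans (by gcongr) h1
        have h4 : δ * (1 + ‖y‖) ≤ 2 * dist x y := le_trans (by gcongr) h2
        have h5 : M * (δ * (1 + ‖x‖) + δ * (1 + ‖y‖)) ≤ M * (4 * dist x y) := by
          gcongr; linarith
        rw [div_mul_eq_mul_div, le_div_iff₀ hδ0]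
        linarith
  obtain ⟨L, hL0, hL⟩ := key
  refine ⟨L + 1, by positivity, fun x hx y hy => ?_⟩
  have h1 := hL x hx y hy
    ⟨mem_closedBall_zero_iff.2 (norm_radial_lt_one x).le,
      mem_closedBall_zero_iff.2 (norm_radial_lt_one y).le⟩
  rw [edist_dist, ← ENNReal.ofReal_mul (by positivity)]
  exact h1.trans (ENNReal.ofReal_le_ofReal (by gcongr; linarith))

theorem IsLNENear.connectedComponentIn {X : Set E} {α : E} (h : IsLNENear X α) (x₀ : E) :
    IsLNENear (connectedComponentIn X x₀) α := by
  obtain ⟨S, hS, L, hL0, hL⟩ := h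
  refine ⟨S, hS, L, hL0, fun x hx y hy hxS hyS => ?_⟩
  exact (innerDist_connectedComponentIn_le hx).trans
    (hL x (connectedComponentIn_subset _ _ hx) y (connectedComponentIn_subset _ _ hy) hxS hyS)

theorem isLNE_connectedComponentIn [ProperSpace E] {X : Set E}
    (h : ∀ α ∈ closedBall (0 : E) 1, IsLNENear X α) (x₀ : E) :
    IsLNE (connectedComponentIn X x₀) :=
  isLNE_of_isLNENear isPreconnected_connectedComponentIn
    fun α hα => (h α hα).connectedComponentIn x₀

end Global

end ConicLNE

namespace ConicLNE

open Set Filter Topology Metric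
open scoped NNReal ENNReal

/-! ### Straightening a zero set while keeping the `ℝ` coordinate -/

section LevelChart

variable {E Y : Type*} [NormedAddCommGroup E] [NormedSpace ℝ E] [FiniteDimensional ℝ E]
  [NormedAddCommGroup Y] [NormedSpace ℝ Y] [FiniteDimensional ℝ Y]

/-- Analytic coordinates of `ℝ × E`, compatible with the projection to `ℝ`, which straighten the
zero set of a map whose partial derivative in the `E` direction is surjective. -/
theorem exists_levelChart {G : ℝ × E → Y} (hG : ContDiff ℝ ω G) {x₀ : ℝ × E} (h₀ : G x₀ = 0)
    (hsurj : ∀ y, ∃ w : E, fderiv ℝ G x₀ (0, w) = y) :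
    ∃ (Φ : OpenPartialHomeomorph (ℝ × E) (ℝ × E)) (W : Submodule ℝ E),
      x₀ ∈ Φ.source ∧ Φ x₀ = 0 ∧ ContDiffOn ℝ ω Φ Φ.source ∧ ContDiffOn ℝ ω Φ.symm Φ.target ∧
      (∀ x, (Φ x).1 = x.1 - x₀.1) ∧ (∀ x, G x = 0 ↔ (Φ x).2 ∈ W) ∧
      (∀ q, (fderiv ℝ Φ x₀ q).2 ∈ W ↔ fderiv ℝ G x₀ q = 0) ∧
      ∀ q, (fderiv ℝ Φ x₀ q).1 = q.1 := by
  have : CompleteSpace E := FiniteDimensional.complete ℝ E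
  set G' := fderiv ℝ G x₀ with hG'
  set D : E →L[ℝ] Y := G'.comp (ContinuousLinearMap.inr ℝ ℝ E) with hD
  obtain ⟨R₀, hR₀⟩ := LinearMap.exists_rightInverse_of_surjective (D : E →ₗ[ℝ] Y)
    (LinearMap.range_eq_top.2 fun y => hsurj y)
  set R : Y →L[ℝ] E := LinearMap.toContinuousLinearMap R₀ with hR
  have hDR : ∀ y, D (R y) = y := fun y => LinearMap.congr_fun hR₀ y
  have hsplit : ∀ q : ℝ × E, G' q = G' (q.1, 0) + D q.2 := by
    intro q
    rw [hD, ContinuousLinearMap.comp_apply, ContinuousLinearMap.inr_apply, ← map_add]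
    simp
  let Q : ℝ × E →L[ℝ] E := R.comp (G'.comp
    ((ContinuousLinearMap.inl ℝ ℝ E).comp (ContinuousLinearMap.fst ℝ ℝ E)))
  let A : ℝ × E →L[ℝ] ℝ × E := (ContinuousLinearMap.fst ℝ ℝ E).prod
    (ContinuousLinearMap.snd ℝ ℝ E + Q)
  let B : ℝ × E →L[ℝ] ℝ × E := (ContinuousLinearMap.fst ℝ ℝ E).prod
    (ContinuousLinearMap.snd ℝ ℝ E - Q)
  let e : (ℝ × E) ≃L[ℝ] ℝ × E := ContinuousLinearEquiv.equivOfInverse A B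
    (fun q => by simp [A, B, Q]) (fun q => by simp [A, B, Q])
  -- In the `E` coordinate, the component along the range of `R` is replaced by `R (G x)`. Then `D
  -- (φ x).2 = G x`, so the zero set becomes the preimage of `ker D`.
  let φ : ℝ × E → ℝ × E := fun x =>
    (x.1 - x₀.1, (x.2 - x₀.2) - R (D (x.2 - x₀.2)) + R (G x))
  have hφ : ContDiff ℝ ω φ := by fun_prop
  have hφ' : HasFDerivAt φ (e : ℝ × E →L[ℝ] ℝ × E) x₀ := by
    have hGd : HasFDerivAt G G' x₀ := (hG.differentiable (by simp)).differentiableAt.hasFDerivAt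
    have h1 : HasFDerivAt (fun x : ℝ × E => x.2 - x₀.2) (ContinuousLinearMap.snd ℝ ℝ E) x₀ :=
      hasFDerivAt_snd.sub_const _
    have h2 : HasFDerivAt (fun x : ℝ × E => x.1 - x₀.1) (ContinuousLinearMap.fst ℝ ℝ E) x₀ :=
      hasFDerivAt_fst.sub_const _
    have h3 := h2.prodMk ((h1.sub ((R.comp D).hasFDerivAt.comp x₀ h1)).add
      (R.hasFDerivAt.comp x₀ hGd))
    refine h3.congr_fderiv ?_
    ext q
    · simp [e, A]
    · simp [e, A, Q]
    · simp [e, A]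
    · have h00 : G' (0, 0) = 0 := G'.map_zero
      simp [e, A, Q, hD, h00]
  have hω : (ω : WithTop ℕ∞) ≠ 0 := by simp
  let Φ₀ := hφ.contDiffAt.toOpenPartialHomeomorph φ hφ' hω
  have hφ0 : φ x₀ = 0 := by simp [φ, h₀]
  have hωinf : (ω : WithTop ℕ∞) ≠ ((⊤ : ℕ∞) : WithTop ℕ∞) := by simp
  -- The inverse function theorem gives analyticity of the inverse only at the centre; shrinking the
  -- domain gives it throughout, in both directions.
  let Φ := Φ₀.restrContDiff ℝ ω hωinf
  have hΦ : ∀ x, Φ x = φ x := fun x => rfl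
  have hΦ' : (Φ : ℝ × E → ℝ × E) = φ := rfl
  have hDφ : ∀ x, D (φ x).2 = G x := fun x => by
    simp only [φ, map_add, map_sub, hDR, sub_self, zero_add]
  refine ⟨Φ, LinearMap.ker (D : E →ₗ[ℝ] Y), ?_, by rw [hΦ, hφ0], ?_, ?_, fun x => rfl,
    fun x => ?_, fun q => ?_, fun q => ?_⟩
  · refine ⟨hφ.contDiffAt.mem_toOpenPartialHomeomorph_source hφ' hω, hφ.contDiffAt, ?_⟩
    exact hφ.contDiffAt.to_localInverse hφ' hω
  · exact Φ₀.contDiffOn_restrContDiff_source ℝ hωinf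
  · exact Φ₀.contDiffOn_restrContDiff_target ℝ hωinf
  · rw [LinearMap.mem_ker, hΦ]
    exact (hDφ x) ▸ Iff.rfl
  · rw [LinearMap.mem_ker, hΦ', hφ'.fderiv, hsplit q]
    have : D (e q).2 = G' (q.1, 0) + D q.2 := by
      change D (q.2 + R (G' (q.1, 0))) = _
      rw [map_add, hDR, add_comm]
    exact this ▸ Iff.rfl
  · rw [hΦ', hφ'.fderiv]; rfl

/-- Nearby zeros of a map with surjective partial derivative in the `E` direction are the corners
of a Lipschitz rectangle of zeros, one side of which is the `ℝ` direction. -/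
theorem exists_lipschitz_rectangle {G : ℝ × E → Y} (hG : ContDiff ℝ ω G) {x₀ : ℝ × E}
    (h₀ : G x₀ = 0) (hsurj : ∀ y, ∃ w : E, fderiv ℝ G x₀ (0, w) = y) :
    ∃ δ : ℝ, 0 < δ ∧ ∃ K : ℝ, 0 ≤ K ∧ ∀ p ∈ ball x₀ δ, ∀ q ∈ ball x₀ δ, G p = 0 → G q = 0 →
      ∃ η : ℝ → ℝ → E, η p.1 0 = p.2 ∧ η q.1 1 = q.2 ∧
        (∀ ρ ∈ uIcc p.1 q.1, ∀ t ∈ Icc (0 : ℝ) 1, G (ρ, η ρ t) = 0) ∧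
        ∀ ρ ∈ uIcc p.1 q.1, ∀ t ∈ Icc (0 : ℝ) 1, ∀ ρ' ∈ uIcc p.1 q.1, ∀ t' ∈ Icc (0 : ℝ) 1,
          dist (η ρ t) (η ρ' t') ≤ K * |ρ - ρ'| + K * dist p q * |t - t'| := by
  obtain ⟨Φ, W, hx₀, hΦ0, hs, hss, hfst, hmem, -, -⟩ := exists_levelChart hG h₀ hsurj
  have hω : (1 : WithTop ℕ∞) ≤ ω := le_top
  obtain ⟨K₁, s₁, hs₁, hK₁⟩ :=
    ((hs.contDiffAt (Φ.open_source.mem_nhds hx₀)).of_le hω).exists_lipschitzOnWith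
  have h0t : (0 : ℝ × E) ∈ Φ.target := hΦ0 ▸ Φ.map_source hx₀
  obtain ⟨K₂, s₂, hs₂, hK₂⟩ :=
    ((hss.contDiffAt (Φ.open_target.mem_nhds h0t)).of_le hω).exists_lipschitzOnWith
  obtain ⟨ε, hε, hεs⟩ := Metric.mem_nhds_iff.1 (inter_mem hs₂ (Φ.open_target.mem_nhds h0t))
  have hcont : Φ ⁻¹' ball 0 ε ∈ 𝓝 x₀ := (Φ.continuousAt hx₀) (hΦ0 ▸ ball_mem_nhds _ hε)
  obtain ⟨δ, hδ, hδs⟩ := Metric.mem_nhds_iff.1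
    (inter_mem (inter_mem hs₁ (Φ.open_source.mem_nhds hx₀)) hcont)
  refine ⟨δ, hδ, K₂ + K₂ * K₁, by positivity, fun p hp q hq hGp hGq => ?_⟩
  -- A flat rectangle in the straightened coordinates: `ρ` is prescribed and the component in `W`
  -- moves along a segment. Balls for the sup norm are products, so it stays in the ball.
  let z : ℝ → ℝ → ℝ × E := fun ρ t => (ρ - x₀.1, (1 - t) • (Φ p).2 + t • (Φ q).2)
  have hpε : Φ p ∈ ball 0 ε := (hδs hp).2
  have hqε : Φ q ∈ ball 0 ε := (hδs hq).2
  have hz : ∀ ρ ∈ uIcc p.1 q.1, ∀ t ∈ Icc (0 : ℝ) 1, z ρ t ∈ ball 0 ε := by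
    intro ρ hρ t ht
    rw [← Prod.mk_zero_zero, ← ball_prod_same] at hpε hqε ⊢
    refine ⟨?_, (convex_ball (0 : E) ε) hpε.2 hqε.2 (sub_nonneg.2 ht.2) ht.1 (by ring)⟩
    have h1 := hpε.1
    have h2 := hqε.1
    rw [hfst, mem_ball_zero_iff, Real.norm_eq_abs, abs_lt] at h1 h2
    change ρ - x₀.1 ∈ _
    rw [mem_ball_zero_iff, Real.norm_eq_abs, abs_lt]
    rcases mem_uIcc.1 hρ with h | h
    · exact ⟨by linarith [h.1], by linarith [h.2]⟩
    · exact ⟨by linarith [h.1], by linarith [h.2]⟩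
  have hsymm : ∀ ρ ∈ uIcc p.1 q.1, ∀ t ∈ Icc (0 : ℝ) 1,
      Φ.symm (z ρ t) = (ρ, (Φ.symm (z ρ t)).2) := by
    intro ρ hρ t ht
    have h1 := hfst (Φ.symm (z ρ t))
    rw [Φ.right_inv (hεs (hz ρ hρ t ht)).2] at h1
    have h2 : ρ - x₀.1 = (Φ.symm (z ρ t)).1 - x₀.1 := h1
    exact Prod.ext (by simpa using h2.symm) rfl
  refine ⟨fun ρ t => (Φ.symm (z ρ t)).2, ?_, ?_, fun ρ hρ t ht => ?_,
    fun ρ hρ t ht ρ' hρ' t' ht' => ?_⟩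
  · have : z p.1 0 = Φ p := Prod.ext (hfst p).symm (by simp [z])
    simp only [this, Φ.left_inv (hδs hp).1.2]
  · have : z q.1 1 = Φ q := Prod.ext (hfst q).symm (by simp [z])
    simp only [this, Φ.left_inv (hδs hq).1.2]
  · rw [← hsymm ρ hρ t ht, hmem, Φ.right_inv (hεs (hz ρ hρ t ht)).2]
    exact W.add_mem (W.smul_mem _ ((hmem p).1 hGp)) (W.smul_mem _ ((hmem q).1 hGq))
  · have h1 : dist (Φ.symm (z ρ t)) (Φ.symm (z ρ' t')) ≤ K₂ * dist (z ρ t) (z ρ' t') :=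
      hK₂.dist_le_mul _ (hεs (hz ρ hρ t ht)).1 _ (hεs (hz ρ' hρ' t' ht')).1
    have h2 : dist (z ρ t) (z ρ' t') ≤ |ρ - ρ'| + |t - t'| * (K₁ * dist p q) := by
      have h3 : dist (z ρ t).1 (z ρ' t').1 = |ρ - ρ'| := by
        rw [Real.dist_eq]; congr 1; simp [z]
      -- The `W` component does not depend on `ρ`, and its speed in `t` is the distance of the
      -- endpoints. This is why the bound in `t` carries the factor `dist p q`.
      have h4 : dist (z ρ t).2 (z ρ' t').2 ≤ |t - t'| * (K₁ * dist p q) := by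
        have h5 : (z ρ t).2 - (z ρ' t').2 = (t' - t) • ((Φ p).2 - (Φ q).2) := by
          simp only [z]; module
        rw [dist_eq_norm, h5, norm_smul, Real.norm_eq_abs, abs_sub_comm, ← dist_eq_norm]
        gcongr
        exact (le_max_right _ _).trans (hK₁.dist_le_mul _ (hδs hp).1.1 _ (hδs hq).1.1)
      rw [Prod.dist_eq, h3]
      exact max_le_iff.2 ⟨le_add_of_nonneg_right (by positivity),
        h4.trans (le_add_of_nonneg_left (by positivity))⟩
    calc dist (Φ.symm (z ρ t)).2 (Φ.symm (z ρ' t')).2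
        ≤ dist (Φ.symm (z ρ t)) (Φ.symm (z ρ' t')) := le_max_right _ _
      _ ≤ K₂ * (|ρ - ρ'| + |t - t'| * (K₁ * dist p q)) := h1.trans (by gcongr)
      _ = K₂ * |ρ - ρ'| + K₂ * K₁ * dist p q * |t - t'| := by ring
      _ ≤ (K₂ + K₂ * K₁) * |ρ - ρ'| + (K₂ + K₂ * K₁) * dist p q * |t - t'| := by
          gcongr
          · exact le_add_of_nonneg_right (by positivity)
          · exact le_add_of_nonneg_left (by positivity)

end LevelChart

/-! ### Local estimate at a finite regular point -/

section LocalLNE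

variable {E Y : Type*} [NormedAddCommGroup E] [NormedSpace ℝ E] [FiniteDimensional ℝ E]
  [NormedAddCommGroup Y] [NormedSpace ℝ Y] [FiniteDimensional ℝ Y]

theorem exists_innerDist_le_of_regular {g : E → Y} (hg : ContDiff ℝ ω g) {a : E} (ha : g a = 0)
    (hsurj : Function.Surjective (fderiv ℝ g a)) :
    ∃ δ : ℝ, 0 < δ ∧ ∃ L : ℝ, 0 ≤ L ∧ ∀ x ∈ ball a δ, ∀ y ∈ ball a δ, g x = 0 → g y = 0 →
      innerDist {x | g x = 0} x y ≤ ENNReal.ofReal (L * dist x y) := by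
  have hd : fderiv ℝ (fun x : ℝ × E => g x.2) (0, a)
      = (fderiv ℝ g a).comp (ContinuousLinearMap.snd ℝ ℝ E) :=
    (((hg.differentiable (by simp)) a).hasFDerivAt.comp ((0 : ℝ), a) hasFDerivAt_snd).fderiv
  -- An equation independent of `r`: the rectangle degenerates to its side over `ρ = 0`.
  obtain ⟨δ, hδ, K, hK, h⟩ := exists_lipschitz_rectangle (G := fun x : ℝ × E => g x.2)
    (x₀ := (0, a)) (by fun_prop) ha (fun y => by simpa [hd] using hsurj y)
  refine ⟨δ, hδ, K, hK, fun x hx y hy hgx hgy => ?_⟩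
  have hb : ∀ x ∈ ball a δ, ((0 : ℝ), x) ∈ ball ((0 : ℝ), a) δ := fun x hx => by
    rw [← ball_prod_same]; exact ⟨mem_ball_self hδ, hx⟩
  obtain ⟨η, h0, h1, hη, hL⟩ := h (0, x) (hb x hx) (0, y) (hb y hy) hgx hgy
  have h0m : (0 : ℝ) ∈ uIcc (0 : ℝ) 0 := by simp
  have hd0 : dist ((0 : ℝ), x) ((0 : ℝ), y) = dist x y := by simp [Prod.dist_eq]
  have := innerDist_le_of_lipschitzOnWith (S := {x | g x = 0}) (g := η 0)
    (K := (K * dist x y).toNNReal) zero_le_one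
    (LipschitzOnWith.of_dist_le_mul fun t ht t' ht' => by
      have := hL 0 h0m t ht 0 h0m t' ht'
      rw [hd0] at this
      rw [Real.coe_toNNReal _ (by positivity), Real.dist_eq]
      simpa using this) h0 h1 (fun t ht => hη 0 h0m t ht)
  rwa [Real.coe_toNNReal _ (by positivity), sub_zero, mul_one] at this

end LocalLNE

end ConicLNE

namespace ConicLNE

open Set Filter Topology Metric
open scoped NNReal ENNReal

/-! ### Equations at infinity: p-sub-manifolds and estimates near the sphere -/

section Infinity

variable {E Y : Type*} [NormedAddCommGroup E] [NormedSpace ℝ E]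
  [NormedAddCommGroup Y] [NormedSpace ℝ Y]

/-- `G` is an analytic equation for `X` in the chart `[0, ∞) × 𝕊` at infinity. -/
structure IsEquationAtInfinity (G : ℝ × E → Y) (X : Set E) : Prop where
  contDiff : ContDiff ℝ ω G
  norm_eq : ∀ q, G q = 0 → ‖q.2‖ = 1
  mem_iff : ∀ q : ℝ × E, 0 < q.1 → ‖q.2‖ = 1 → (G q = 0 ↔ q.1⁻¹ • q.2 ∈ X)
  surjective : ∀ u : E, G (0, u) = 0 → ∀ y, ∃ w : E, fderiv ℝ G (0, u) (0, w) = y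

namespace IsEquationAtInfinity

variable {G : ℝ × E → Y} {X : Set E}

theorem closureAtInfinity_eq (h : IsEquationAtInfinity G X) :
    closureAtInfinity X = closure {q | 0 < q.1 ∧ G q = 0} := by
  unfold closureAtInfinity
  congr 1
  ext q
  constructor
  · rintro ⟨h1, h2, h3⟩
    exact ⟨h1, (h.mem_iff q h1 h2).2 h3⟩
  · rintro ⟨h1, h2⟩
    exact ⟨h1, h.norm_eq q h2, (h.mem_iff q h1 (h.norm_eq q h2)).1 h2⟩

theorem of_mem_closureAtInfinity (h : IsEquationAtInfinity G X) {q : ℝ × E}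
    (hq : q ∈ closureAtInfinity X) : 0 ≤ q.1 ∧ G q = 0 := by
  rw [h.closureAtInfinity_eq] at hq
  have hc : IsClosed {q : ℝ × E | 0 ≤ q.1 ∧ G q = 0} :=
    (isClosed_le continuous_const continuous_fst).inter
      (isClosed_eq h.contDiff.continuous continuous_const)
  have hsub : {q : ℝ × E | 0 < q.1 ∧ G q = 0} ⊆ {q | 0 ≤ q.1 ∧ G q = 0} :=
    fun _ hq => ⟨hq.1.le, hq.2⟩
  exact closure_minimal hsub hc hq

theorem isPSubmanifoldAt [FiniteDimensional ℝ E] [FiniteDimensional ℝ Y]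
    (h : IsEquationAtInfinity G X) {u : E} (hu : G (0, u) = 0)
    (hT : ∀ q, fderiv ℝ G (0, u) q = 0 → q.2 ∈ sphereTangent u) :
    IsPSubmanifoldAt (closureAtInfinity X) u := by
  obtain ⟨Φ, W, hx₀, hΦ0, hs, hss, hfst, hmem, hder, hderfst⟩ :=
    exists_levelChart h.contDiff hu (h.surjective u hu)
  have hfst' : ∀ x, (Φ x).1 = x.1 := fun x => by rw [hfst, sub_zero]
  refine ⟨Φ, (⊤ : Submodule ℝ ℝ).prod W, ContinuousLinearMap.fst ℝ ℝ E,
    ⟨hx₀, hΦ0, hs.of_le le_top, hss.of_le le_top,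
      ⟨(1, 0), ⟨trivial, W.zero_mem⟩, one_ne_zero⟩, fun x hx => ⟨fun hN => ?_, ?_⟩⟩,
    fun x _ _ => ?_, ?_⟩
  · obtain ⟨h0, h1⟩ := h.of_mem_closureAtInfinity hN
    exact ⟨⟨trivial, (hmem x).1 h1⟩, by simpa [hfst'] using h0⟩
  · rintro ⟨⟨-, hW⟩, hl⟩
    have hl' : 0 ≤ x.1 := by simpa [hfst'] using hl
    rw [h.closureAtInfinity_eq]
    -- Zeros with `r = 0` must be shown to be limits of points of `X`: pushing in the direction of
    -- `r` inside the chart stays in the zero set and makes `r` positive.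
    let γ : ℝ → ℝ × E := fun t => Φ.symm (Φ x + t • ((1 : ℝ), (0 : E)))
    have hin : Tendsto (fun t : ℝ => Φ x + t • ((1 : ℝ), (0 : E))) (𝓝[>] 0) (𝓝 (Φ x)) := by
      have hc : Continuous (fun t : ℝ => Φ x + t • ((1 : ℝ), (0 : E))) := by fun_prop
      have := hc.tendsto 0
      rw [zero_smul, add_zero] at this
      exact this.mono_left nhdsWithin_le_nhds
    have hxt := Φ.map_source hx
    have hγ : Tendsto γ (𝓝[>] 0) (𝓝 x) := by
      have := (Φ.continuousAt_symm hxt).tendsto.comp hin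
      rwa [Φ.left_inv hx] at this
    refine mem_closure_of_tendsto hγ ?_
    filter_upwards [hin (Φ.open_target.mem_nhds hxt), self_mem_nhdsWithin] with t ht ht0
    have ht0' : 0 < t := ht0
    have hr : Φ (γ t) = Φ x + t • ((1 : ℝ), (0 : E)) := Φ.right_inv ht
    refine ⟨?_, (hmem _).2 ?_⟩
    · rw [← hfst', hr]
      simp only [Prod.fst_add, Prod.smul_fst, smul_eq_mul, mul_one, hfst']
      linarith
    · rw [hr]; simpa using hW
  · simp [hfst']
  · have hcomap : ∀ q, q ∈ ((⊤ : Submodule ℝ ℝ).prod W).comap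
        (fderiv ℝ Φ (0, u)).toLinearMap ↔ fderiv ℝ G (0, u) q = 0 := fun q => by
      rw [← hder q]; simp
    apply le_antisymm
    · refine sup_le (fun q hq => ⟨trivial, hT q ((hcomap q).1 hq)⟩) ?_
      exact Submodule.prod_mono bot_le le_rfl
    · rintro ⟨s, w⟩ ⟨-, hw⟩
      -- Transversality: surjectivity in the `E` direction lifts any `s` to a vector `(s, w₀)`
      -- tangent to the zero set; the remainder is tangent to the sphere at infinity.
      obtain ⟨w₀, hw₀⟩ := h.surjective u hu (-fderiv ℝ G (0, u) (s, 0))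
      have h1 : fderiv ℝ G (0, u) (s, w₀) = 0 := by
        have : (s, w₀) = (s, (0 : E)) + ((0 : ℝ), w₀) := by simp
        rw [this, map_add, hw₀, add_neg_cancel]
      refine Submodule.mem_sup.2 ⟨(s, w₀), (hcomap _).2 h1, (0, w - w₀), ⟨by simp, ?_⟩, by simp⟩
      exact Submodule.sub_mem _ hw (hT _ h1)

theorem asymptoticSet_nonempty [ProperSpace E] (hX : ¬ Bornology.IsBounded X) :
    (asymptoticSet X).Nonempty := by
  have hex : ∀ k : ℕ, ∃ x ∈ X, (k : ℝ) + 1 ≤ ‖x‖ := by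
    intro k
    by_contra! hk
    exact hX (isBounded_iff_forall_norm_le.2 ⟨k + 1, fun x hx => (hk x hx).le⟩)
  choose x hxX hxk using hex
  have hpos : ∀ k, 0 < ‖x k‖ := fun k => lt_of_lt_of_le (by positivity) (hxk k)
  have hsph : ∀ k, ‖x k‖⁻¹ • x k ∈ sphere (0 : E) 1 := fun k => by
    rw [mem_sphere_zero_iff_norm, norm_smul, norm_inv, norm_norm,
      inv_mul_cancel₀ (hpos k).ne']
  obtain ⟨u, -, φ, hφ, hu⟩ := (isCompact_sphere (0 : E) 1).tendsto_subseq hsph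
  refine ⟨u, ?_⟩
  have hr : Tendsto (fun k => ‖x k‖⁻¹) atTop (𝓝 0) := by
    refine tendsto_inv_atTop_zero.comp (tendsto_atTop_mono hxk ?_)
    exact tendsto_atTop_add_const_right _ _ tendsto_natCast_atTop_atTop
  refine mem_closure_of_tendsto ((hr.comp hφ.tendsto_atTop).prodMk_nhds hu)
    (Eventually.of_forall fun k => ⟨inv_pos.2 (hpos _), ?_, ?_⟩)
  · exact mem_sphere_zero_iff_norm.1 (hsph (φ k))
  · simp only [Function.comp_apply, inv_inv, smul_inv_smul₀ (hpos (φ k)).ne']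
    exact hxX _

theorem isConicAtInfinity [FiniteDimensional ℝ E] [FiniteDimensional ℝ Y]
    (h : IsEquationAtInfinity G X)
    (hT : ∀ u, G (0, u) = 0 → ∀ q, fderiv ℝ G (0, u) q = 0 → q.2 ∈ sphereTangent u) :
    IsConicAtInfinity X := by
  have := FiniteDimensional.proper ℝ E
  by_cases hX : Bornology.IsBounded X
  · exact Or.inl hX
  · refine Or.inr ⟨asymptoticSet_nonempty hX, fun u hu => ?_⟩
    have hGu := (h.of_mem_closureAtInfinity hu).2
    exact h.isPSubmanifoldAt hGu (hT u hGu)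

end IsEquationAtInfinity

/-- The coordinates of the chart at infinity, in terms of the radial compactification. -/
noncomputable def radialToInfinity (β : E) : ℝ × E := ((1 - ‖β‖) * ‖β‖⁻¹, ‖β‖⁻¹ • β)

theorem continuousAt_radialToInfinity {β : E} (hβ : β ≠ 0) :
    ContinuousAt (radialToInfinity : E → ℝ × E) β := by
  have h : ContinuousAt (fun β : E => ‖β‖⁻¹) β :=
    continuous_norm.continuousAt.inv₀ (norm_ne_zero_iff.2 hβ)
  exact ((continuousAt_const.sub continuous_norm.continuousAt).mul h).prodMk
    (h.smul continuousAt_id)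

theorem radialToInfinity_of_norm_eq_one {β : E} (hβ : ‖β‖ = 1) :
    radialToInfinity β = (0, β) := by
  simp [radialToInfinity, hβ]

theorem radialToInfinity_radial {x : E} (hx : x ≠ 0) :
    radialToInfinity (radial x) = (‖x‖⁻¹, ‖x‖⁻¹ • x) := by
  have h0 : ‖x‖ ≠ 0 := norm_ne_zero_iff.2 hx
  have h1 : 1 + ‖x‖ ≠ 0 := by positivity
  rw [radialToInfinity, one_sub_norm_radial, norm_radial, radial, smul_smul, inv_div]
  congr 1
  · field_simp
  · congr 1
    field_simp

theorem radial_ne_zero_iff {x : E} : radial x ≠ 0 ↔ x ≠ 0 := by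
  have h1 : (1 + ‖x‖)⁻¹ ≠ 0 := inv_ne_zero (by positivity)
  simp [radial, h1]

/-- Distances in the chart at infinity, scaled back by the smaller of the two norms, are controlled
by Euclidean distances. -/
theorem norm_mul_dist_chart_le {x y : E} (hy : 1 ≤ ‖y‖) (hyx : ‖y‖ ≤ ‖x‖) :
    ‖y‖ * dist (‖x‖⁻¹, ‖x‖⁻¹ • x) (‖y‖⁻¹, ‖y‖⁻¹ • y) ≤ 2 * dist x y := by
  have hy0 : 0 < ‖y‖ := by linarith
  have hx0 : 0 < ‖x‖ := by linarith
  have hsub : ‖x‖ - ‖y‖ ≤ dist x y := by rw [dist_eq_norm]; exact norm_sub_norm_le x y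
  rw [Prod.dist_eq, mul_max_of_nonneg _ _ hy0.le]
  refine max_le ?_ ?_
  · have h1 : dist ‖x‖⁻¹ ‖y‖⁻¹ = ‖y‖⁻¹ - ‖x‖⁻¹ := by
      rw [Real.dist_eq, abs_sub_comm, abs_of_nonneg (sub_nonneg.2 (by gcongr))]
    have h2 : ‖y‖ * (‖y‖⁻¹ - ‖x‖⁻¹) = (‖x‖ - ‖y‖) / ‖x‖ := by field_simp
    change ‖y‖ * dist ‖x‖⁻¹ ‖y‖⁻¹ ≤ _
    rw [h1, h2]
    calc (‖x‖ - ‖y‖) / ‖x‖ ≤ ‖x‖ - ‖y‖ :=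
          div_le_self (sub_nonneg.2 hyx) (hy.trans hyx)
      _ ≤ 2 * dist x y := by linarith [dist_nonneg (x := x) (y := y)]
  · have h1 : ‖y‖ • (‖x‖⁻¹ • x - ‖y‖⁻¹ • y) = (x - y) - ((‖x‖ - ‖y‖) * ‖x‖⁻¹) • x := by
      rw [smul_sub, smul_inv_smul₀ hy0.ne', smul_smul]
      have : ‖y‖ * ‖x‖⁻¹ = 1 - (‖x‖ - ‖y‖) * ‖x‖⁻¹ := by field_simp; ring
      rw [this]; module
    have h2 : ‖((‖x‖ - ‖y‖) * ‖x‖⁻¹) • x‖ = ‖x‖ - ‖y‖ := by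
      rw [norm_smul, norm_mul, norm_inv, norm_norm, Real.norm_of_nonneg (sub_nonneg.2 hyx),
        mul_assoc, inv_mul_cancel₀ hx0.ne', mul_one]
    calc ‖y‖ * dist (‖x‖⁻¹ • x) (‖y‖⁻¹ • y) = ‖‖y‖ • (‖x‖⁻¹ • x - ‖y‖⁻¹ • y)‖ := by
          rw [norm_smul, norm_norm, dist_eq_norm]
      _ ≤ ‖x - y‖ + (‖x‖ - ‖y‖) := by
          rw [h1]; exact (norm_sub_le _ _).trans_eq (by rw [h2])
      _ ≤ 2 * dist x y := by rw [← dist_eq_norm]; linarith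

/-- With `‖y‖ ≤ ‖x‖`, one side of the rectangle leads from `x` to a point of norm `‖y‖`, and another
stays on that sphere up to `y`. Turning at the smaller radius is what makes the angular part cheap.
-/
theorem IsEquationAtInfinity.isLNENear [FiniteDimensional ℝ E] [FiniteDimensional ℝ Y]
    {G : ℝ × E → Y} {X : Set E} (h : IsEquationAtInfinity G X) {u : E} (hu : ‖u‖ = 1) :
    IsLNENear X u := by
  have hu0 : u ≠ 0 := norm_ne_zero_iff.1 (by rw [hu]; exact one_ne_zero)
  have hcont := continuousAt_radialToInfinity hu0
  have hval := radialToInfinity_of_norm_eq_one hu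
  have hne : {β : E | β ≠ 0} ∈ 𝓝 u := isOpen_ne.mem_nhds hu0
  have hGX : ∀ x ∈ X, x ≠ 0 → G (‖x‖⁻¹, ‖x‖⁻¹ • x) = 0 := fun x hx hx0 => by
    have hx0' : ‖x‖ ≠ 0 := norm_ne_zero_iff.2 hx0
    rw [h.mem_iff]
    · simpa [smul_smul, hx0'] using hx
    · simpa using hx0
    · simp [norm_smul, hx0']
  by_cases hG : G (0, u) = 0
  · obtain ⟨δ, hδ, K, hK, hrect⟩ :=
      exists_lipschitz_rectangle h.contDiff hG (h.surjective u hG)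
    -- The bound 1 on the radius forces the norms of the points considered to be at least 1.
    have hball : ball ((0 : ℝ), u) (min δ 1) ∈ 𝓝 (radialToInfinity u) := by
      rw [hval]; exact ball_mem_nhds _ (by positivity)
    refine ⟨_, inter_mem hne (hcont hball), 1 + 3 * K, by positivity, ?_⟩
    have key : ∀ x ∈ X, ∀ y ∈ X,
        radial x ∈ {β : E | β ≠ 0} ∩ radialToInfinity ⁻¹' ball ((0 : ℝ), u) (min δ 1) →
        radial y ∈ {β : E | β ≠ 0} ∩ radialToInfinity ⁻¹' ball ((0 : ℝ), u) (min δ 1) →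
        ‖y‖ ≤ ‖x‖ → innerDist X x y ≤ ENNReal.ofReal ((1 + 3 * K) * dist x y) := by
      rintro x hx y hy ⟨hx0, hxb⟩ ⟨hy0, hyb⟩ hyx
      have hx0 := radial_ne_zero_iff.1 hx0
      have hy0 := radial_ne_zero_iff.1 hy0
      rw [mem_preimage, radialToInfinity_radial hx0] at hxb
      rw [mem_preimage, radialToInfinity_radial hy0] at hyb
      have hxn : 0 < ‖x‖ := norm_pos_iff.2 hx0
      have hyn : 0 < ‖y‖ := norm_pos_iff.2 hy0
      have hy1 : 1 ≤ ‖y‖ := by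
        have h1 := ball_subset_ball (min_le_right _ _) hyb
        rw [← ball_prod_same] at h1
        have h2 := h1.1
        rw [mem_ball_zero_iff, norm_inv, norm_norm, inv_lt_one₀ hyn] at h2
        exact h2.le
      have hx1 : 1 ≤ ‖x‖ := hy1.trans hyx
      obtain ⟨η, hηx, hηy, hη, hL⟩ := hrect _ (ball_subset_ball (min_le_left _ _) hxb)
        _ (ball_subset_ball (min_le_left _ _) hyb) (hGX x hx hx0) (hGX y hy hy0)
      have hinv : ‖x‖⁻¹ ≤ ‖y‖⁻¹ := by gcongr
      have hmem : ∀ ρ ∈ Icc ‖x‖⁻¹ ‖y‖⁻¹, ρ ∈ uIcc ‖x‖⁻¹ ‖y‖⁻¹ := fun ρ hρ => by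
        rwa [uIcc_of_le hinv]
      have hηX : ∀ ρ ∈ Icc ‖x‖⁻¹ ‖y‖⁻¹, ∀ t ∈ Icc (0 : ℝ) 1, ρ⁻¹ • η ρ t ∈ X := by
        intro ρ hρ t ht
        have h0 := hη ρ (hmem ρ hρ) t ht
        exact (h.mem_iff _ ((inv_pos.2 hxn).trans_le hρ.1) (h.norm_eq _ h0)).1 h0
      have hyI : ‖y‖⁻¹ ∈ Icc ‖x‖⁻¹ ‖y‖⁻¹ := ⟨hinv, le_rfl⟩
      have h0I : (0 : ℝ) ∈ Icc (0 : ℝ) 1 := ⟨le_rfl, zero_le_one⟩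
      set D := dist (‖x‖⁻¹, ‖x‖⁻¹ • x) (‖y‖⁻¹, ‖y‖⁻¹ • y) with hD
      have hangular : innerDist X (‖y‖ • η ‖y‖⁻¹ 0) y ≤ ENNReal.ofReal (2 * K * dist x y) := by
        have := innerDist_le_of_lipschitzOnWith (S := X) (g := fun t => ‖y‖ • η ‖y‖⁻¹ t)
          (x := ‖y‖ • η ‖y‖⁻¹ 0) (y := y) (K := (‖y‖ * (K * D)).toNNReal) zero_le_one
          (LipschitzOnWith.of_dist_le_mul fun t ht t' ht' => by
            have h1 := hL _ (hmem _ hyI) t ht _ (hmem _ hyI) t' ht'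
            rw [sub_self, abs_zero, mul_zero, zero_add] at h1
            rw [Real.coe_toNNReal _ (by positivity), dist_smul₀, norm_norm, Real.dist_eq,
              mul_assoc]
            gcongr)
          rfl (by rw [hηy, smul_inv_smul₀ hyn.ne'])
          (fun t ht => by simpa using hηX _ hyI t ht)
        rw [Real.coe_toNNReal _ (by positivity), sub_zero, mul_one] at this
        refine this.trans (ENNReal.ofReal_le_ofReal ?_)
        have := norm_mul_dist_chart_le hy1 hyx
        calc ‖y‖ * (K * D) = K * (‖y‖ * D) := by ring
          _ ≤ K * (2 * dist x y) := by gcongr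
          _ = 2 * K * dist x y := by ring
      have hradial : innerDist X (‖y‖ • η ‖y‖⁻¹ 0) x ≤
          ENNReal.ofReal ((1 + K) * dist x y) := by
        have hτ : ∀ τ ∈ Icc ‖y‖ ‖x‖, τ⁻¹ ∈ Icc ‖x‖⁻¹ ‖y‖⁻¹ := fun τ hτ =>
          ⟨inv_anti₀ (hyn.trans_le hτ.1) hτ.2, inv_anti₀ hyn hτ.1⟩
        -- Parametrized by the norm `τ = 1 / ρ`, the side has speed at most `1 + K`: 1 from the
        -- change of norm, `K` from the change of direction, since `τ' * |τ⁻¹ - τ'⁻¹| ≤ |τ - τ'|`.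
        have := innerDist_le_of_lipschitzOnWith (S := X) (g := fun τ => τ • η τ⁻¹ 0)
          (x := ‖y‖ • η ‖y‖⁻¹ 0) (y := x) (K := (1 + K).toNNReal) hyx
          (LipschitzOnWith.of_dist_le_mul fun τ ht τ' ht' => by
            have h1 := hL _ (hmem _ (hτ τ ht)) 0 h0I _ (hmem _ (hτ τ' ht')) 0 h0I
            rw [sub_self, abs_zero, mul_zero, add_zero] at h1
            have hn : ‖η τ⁻¹ 0‖ = 1 := h.norm_eq _ (hη _ (hmem _ (hτ τ ht)) 0 h0I)
            have hτ1 : 1 ≤ τ := hy1.trans ht.1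
            have hτ1' : 1 ≤ τ' := hy1.trans ht'.1
            have h2 : τ' * |τ⁻¹ - τ'⁻¹| ≤ |τ - τ'| := by
              have : τ⁻¹ - τ'⁻¹ = (τ' - τ) * τ⁻¹ * τ'⁻¹ := by field_simp
              rw [this, abs_mul, abs_mul, abs_of_pos (a := τ⁻¹) (by positivity),
                abs_of_pos (a := τ'⁻¹) (by positivity), abs_sub_comm]
              calc τ' * (|τ - τ'| * τ⁻¹ * τ'⁻¹) = |τ - τ'| * τ⁻¹ := by field_simp
                _ ≤ |τ - τ'| := mul_le_of_le_one_right (abs_nonneg _) (inv_le_one_of_one_le₀ hτ1)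
            rw [Real.coe_toNNReal _ (by positivity), Real.dist_eq, dist_eq_norm]
            have h3 : τ • η τ⁻¹ 0 - τ' • η τ'⁻¹ 0
                = (τ - τ') • η τ⁻¹ 0 + τ' • (η τ⁻¹ 0 - η τ'⁻¹ 0) := by module
            rw [h3]
            refine (norm_add_le _ _).trans ?_
            rw [norm_smul, norm_smul, hn, mul_one, Real.norm_eq_abs,
              Real.norm_of_nonneg (by linarith : (0 : ℝ) ≤ τ'), ← dist_eq_norm]
            have h4 : τ' * dist (η τ⁻¹ 0) (η τ'⁻¹ 0) ≤ K * |τ - τ'| :=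
              calc _ ≤ τ' * (K * |τ⁻¹ - τ'⁻¹|) := by gcongr
                _ = K * (τ' * |τ⁻¹ - τ'⁻¹|) := by ring
                _ ≤ _ := by gcongr
            linarith)
          rfl (by rw [hηx, smul_inv_smul₀ hxn.ne'])
          (fun t ht => by simpa using hηX _ (hτ t ht) 0 h0I)
        rw [Real.coe_toNNReal _ (by positivity)] at this
        refine this.trans (ENNReal.ofReal_le_ofReal ?_)
        gcongr
        rw [dist_eq_norm]
        exact norm_sub_norm_le x y
      refine (innerDist_triangle X x (‖y‖ • η ‖y‖⁻¹ 0) y).trans ?_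
      rw [innerDist_comm X x]
      refine (add_le_add hradial hangular).trans ?_
      rw [← ENNReal.ofReal_add (by positivity) (by positivity)]
      exact ENNReal.ofReal_le_ofReal (by linarith)
    intro x hx y hy hxS hyS
    rcases le_total ‖y‖ ‖x‖ with hle | hle
    · exact key x hx y hy hxS hyS hle
    · rw [innerDist_comm, dist_comm]
      exact key y hy x hx hyS hxS hle
  -- Here `u` is not a limit of `X`, and the estimate is vacuous nearby.
  · have hS : {q | G q ≠ 0} ∈ 𝓝 (radialToInfinity u) := by
      rw [hval]
      exact (isOpen_ne_fun h.contDiff.continuous continuous_const).mem_nhds hG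
    refine ⟨_, inter_mem hne (hcont hS), 0, le_rfl, fun x hx y hy hxS hyS => ?_⟩
    have hx0 := radial_ne_zero_iff.1 hxS.1
    have := hxS.2
    rw [mem_preimage, radialToInfinity_radial hx0] at this
    exact absurd (hGX x hx hx0) this

end Infinity

/-! ### Finite points, and assembly of the LNE criterion -/

section Finite

variable {E Y : Type*} [NormedAddCommGroup E] [NormedSpace ℝ E] [FiniteDimensional ℝ E]
  [NormedAddCommGroup Y] [NormedSpace ℝ Y] [FiniteDimensional ℝ Y]

theorem isLNENear_of_regular {g : E → Y} (hg : ContDiff ℝ ω g)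
    (hreg : ∀ a, g a = 0 → Function.Surjective (fderiv ℝ g a)) {α : E} (hα : ‖α‖ < 1) :
    IsLNENear {x | g x = 0} α := by
  set a := (1 - ‖α‖)⁻¹ • α with ha
  have hcont : ContinuousAt (fun β : E => (1 - ‖β‖)⁻¹ • β) α :=
    ((continuousAt_const.sub continuous_norm.continuousAt).inv₀ (sub_pos.2 hα).ne').smul
      continuousAt_id
  by_cases hga : g a = 0
  · obtain ⟨δ, hδ, L, hL0, hL⟩ := exists_innerDist_le_of_regular hg hga (hreg a hga)
    refine ⟨_, hcont (ball_mem_nhds a hδ), L, hL0, fun x hx y hy hxS hyS => ?_⟩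
    rw [mem_preimage, inv_smul_radial] at hxS hyS
    exact hL x hxS y hyS hx hy
  · refine ⟨_, hcont ((isOpen_ne_fun hg.continuous continuous_const).mem_nhds hga), 0, le_rfl,
      fun x hx y hy hxS hyS => ?_⟩
    rw [mem_preimage, inv_smul_radial] at hxS
    exact absurd hx hxS

/-- The components of a regular level whose equation at infinity is regular are LNE. -/
theorem isLNE_connectedComponentIn_of_regular {Y' : Type*} [NormedAddCommGroup Y']
    [NormedSpace ℝ Y'] [FiniteDimensional ℝ Y'] {g : E → Y} (hg : ContDiff ℝ ω g)
    (hreg : ∀ a, g a = 0 → Function.Surjective (fderiv ℝ g a)) {G : ℝ × E → Y'}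
    (hG : IsEquationAtInfinity G {x | g x = 0}) (x₀ : E) :
    IsLNE (connectedComponentIn {x | g x = 0} x₀) := by
  have := FiniteDimensional.proper ℝ E
  refine isLNE_connectedComponentIn (fun α hα => ?_) x₀
  rcases (mem_closedBall_zero_iff.1 hα).lt_or_eq with h | h
  · exact isLNENear_of_regular hg hreg h
  · exact hG.isLNENear h

end Finite

end ConicLNE

namespace ConicLNE

open Set Filter Topology Metric

/-! ### Derivatives and homogeneity of polynomial functions -/

section PolynomialFunctions

variable {𝕜 : Type*} [RCLike 𝕜] {n : ℕ}

/-- The polynomial function on `𝕜ⁿ` defined by `p`. -/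
noncomputable def polyFun (p : MvPolynomial (Fin n) 𝕜) (x : EuclideanSpace 𝕜 (Fin n)) : 𝕜 :=
  MvPolynomial.eval (fun i => x i) p

theorem hasFDerivAt_polyFun (p : MvPolynomial (Fin n) 𝕜) (x : EuclideanSpace 𝕜 (Fin n)) :
    HasFDerivAt (𝕜 := 𝕜) (polyFun p)
      (∑ i, polyFun (MvPolynomial.pderiv i p) x • (EuclideanSpace.proj i :
        EuclideanSpace 𝕜 (Fin n) →L[𝕜] 𝕜)) x := by
  induction p using MvPolynomial.induction_on with
  | C a =>
    have : polyFun (MvPolynomial.C a : MvPolynomial (Fin n) 𝕜) = fun _ => a := by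
      funext x; simp [polyFun]
    rw [this]
    refine (hasFDerivAt_const a x).congr_fderiv ?_
    ext w
    simp [polyFun]
  | add p q hp hq =>
    have : polyFun (p + q) = fun x => polyFun p x + polyFun q x := by
      funext x; simp [polyFun]
    rw [this]
    refine (hp.add hq).congr_fderiv ?_
    rw [← Finset.sum_add_distrib]
    refine Finset.sum_congr rfl fun i _ => ?_
    rw [← add_smul]; simp [polyFun]
  | mul_X p j hp =>
    have : polyFun (p * MvPolynomial.X j) = fun x => polyFun p x * x j := by
      funext x; simp [polyFun]
    rw [this]
    have hj : HasFDerivAt (𝕜 := 𝕜) (fun x : EuclideanSpace 𝕜 (Fin n) => x j)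
      (EuclideanSpace.proj j : EuclideanSpace 𝕜 (Fin n) →L[𝕜] 𝕜) x :=
      (EuclideanSpace.proj j : EuclideanSpace 𝕜 (Fin n) →L[𝕜] 𝕜).hasFDerivAt
    refine (hp.mul hj).congr_fderiv ?_
    ext w
    have hX : ∀ i, MvPolynomial.eval (fun k => x k) (MvPolynomial.pderiv i
        (p * MvPolynomial.X j)) = MvPolynomial.eval (fun k => x k) p * (Pi.single i (1 : 𝕜) :
          Fin n → 𝕜) j + x j * MvPolynomial.eval (fun k => x k) (MvPolynomial.pderiv i p) := by
      intro i
      rw [Derivation.leibniz, MvPolynomial.pderiv_X]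
      rcases eq_or_ne j i with rfl | h
      · simp
      · simp [h]
    simp only [polyFun, hX, add_smul, Finset.sum_add_distrib, Finset.smul_sum, mul_smul,
      add_apply, sum_apply,
      smul_apply, PiLp.proj_apply]
    congr 1
    simp [Pi.single_apply]

theorem contDiff_polyFun (p : MvPolynomial (Fin n) 𝕜) : ContDiff ℝ ω (polyFun p) := by
  induction p using MvPolynomial.induction_on with
  | C a =>
    have : polyFun (MvPolynomial.C a : MvPolynomial (Fin n) 𝕜) = fun _ => a := by
      funext x; simp [polyFun]
    rw [this]
    exact contDiff_const
  | add p q hp hq =>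
    have : polyFun (p + q) = fun x => polyFun p x + polyFun q x := by
      funext x; simp [polyFun]
    rw [this]
    exact hp.add hq
  | mul_X p j hp =>
    have : polyFun (p * MvPolynomial.X j) = fun x => polyFun p x * x j := by
      funext x; simp [polyFun]
    rw [this]
    exact hp.mul ((EuclideanSpace.proj j :
      EuclideanSpace 𝕜 (Fin n) →L[𝕜] 𝕜).restrictScalars ℝ).contDiff

theorem fderiv_polyFun_apply (p : MvPolynomial (Fin n) 𝕜) (x w : EuclideanSpace 𝕜 (Fin n)) :
    fderiv ℝ (polyFun p) x w = ∑ i, polyFun (MvPolynomial.pderiv i p) x * w i := by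
  rw [((hasFDerivAt_polyFun p x).restrictScalars ℝ).fderiv]
  simp

/-- The real derivative is in fact `𝕜`-linear with the partial derivatives as coefficients, so one
nonzero coefficient makes it onto `𝕜`, also for `𝕜 = ℂ`. -/
theorem surjective_fderiv_polyFun {p : MvPolynomial (Fin n) 𝕜} {x : EuclideanSpace 𝕜 (Fin n)}
    (hx : x ∉ critLocus p) : Function.Surjective (fderiv ℝ (polyFun p) x) := by
  intro z
  simp only [critLocus, mem_ofPred_eq, not_forall] at hx
  obtain ⟨j, hj⟩ := hx
  change polyFun (MvPolynomial.pderiv j p) x ≠ 0 at hj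
  refine ⟨EuclideanSpace.single j (z / polyFun (MvPolynomial.pderiv j p) x), ?_⟩
  rw [fderiv_polyFun_apply, Finset.sum_eq_single j]
  · simp [mul_div_cancel₀ _ hj]
  · intro i _ hij
    simp [hij]
  · simp

theorem polyFun_real_smul {p : MvPolynomial (Fin n) 𝕜} {k : ℕ} (hp : p.IsHomogeneous k) (t : ℝ)
    (x : EuclideanSpace 𝕜 (Fin n)) : polyFun p (t • x) = (t : 𝕜) ^ k * polyFun p x := by
  simp only [polyFun, MvPolynomial.eval_eq', Finset.mul_sum]
  refine Finset.sum_congr rfl fun d hd => ?_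
  have hdeg : d.degree = k := by
    by_contra h
    exact MvPolynomial.mem_support_iff.1 hd (hp.coeff_eq_zero h)
  have : ∏ i, (t • x) i ^ d i = (t : 𝕜) ^ k * ∏ i, x i ^ d i := by
    rw [← hdeg, Finsupp.degree_eq_sum, ← Finset.prod_pow_eq_pow_sum, ← Finset.prod_mul_distrib]
    refine Finset.prod_congr rfl fun i _ => ?_
    rw [← mul_pow, PiLp.smul_apply, RCLike.real_smul_eq_coe_mul]
  rw [this]
  ring

/-- Euler's identity: the derivative in the radial direction is a multiple of the value, here zero.
-/
theorem fderiv_polyFun_real_smul_self {p : MvPolynomial (Fin n) 𝕜} {k : ℕ}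
    (hp : p.IsHomogeneous k) {x : EuclideanSpace 𝕜 (Fin n)} (hx : polyFun p x = 0) (t : ℝ) :
    fderiv ℝ (polyFun p) x (t • x) = 0 := by
  have h := congrArg (MvPolynomial.eval fun i => x i) hp.sum_X_mul_pderiv
  rw [map_nsmul, show MvPolynomial.eval (fun i => x i) p = 0 from hx, smul_zero, map_sum] at h
  rw [map_smul, fderiv_polyFun_apply]
  simp only [map_mul, MvPolynomial.eval_X] at h
  rw [Finset.sum_congr rfl fun i _ => mul_comm _ _]
  exact (congrArg (t • ·) h).trans (smul_zero t)

theorem fderiv_norm_sq_self (x : EuclideanSpace 𝕜 (Fin n)) :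
    fderiv ℝ (fun v : EuclideanSpace 𝕜 (Fin n) => ‖v‖ ^ 2) x x = 2 * ‖x‖ ^ 2 := by
  simp

end PolynomialFunctions

/-! ### The level as a regular zero set at infinity -/

section Homogenization

variable {𝕜 : Type*} [RCLike 𝕜] {n : ℕ}

/-- The homogenization of `f - c`, with a real homogenizing variable. -/
noncomputable def homogenization (f : MvPolynomial (Fin n) 𝕜) (c : 𝕜)
    (q : ℝ × EuclideanSpace 𝕜 (Fin n)) : 𝕜 :=
  ∑ k ∈ Finset.range (f.totalDegree + 1),
    (q.1 : 𝕜) ^ (f.totalDegree - k) * polyFun (MvPolynomial.homogeneousComponent k f) q.2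
  - c * (q.1 : 𝕜) ^ f.totalDegree

theorem contDiff_homogenization (f : MvPolynomial (Fin n) 𝕜) (c : 𝕜) :
    ContDiff ℝ ω (homogenization f c) := by
  have h1 : ContDiff ℝ ω (fun q : ℝ × EuclideanSpace 𝕜 (Fin n) => (q.1 : 𝕜)) :=
    (RCLike.ofRealCLM (K := 𝕜)).contDiff.comp contDiff_fst
  unfold homogenization
  exact (ContDiff.sum fun k _ => (h1.pow _).mul ((contDiff_polyFun _).comp contDiff_snd)).sub
    (contDiff_const.mul (h1.pow _))

theorem homogenization_of_ne_zero (f : MvPolynomial (Fin n) 𝕜) (c : 𝕜)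
    {q : ℝ × EuclideanSpace 𝕜 (Fin n)} (hq : q.1 ≠ 0) :
    homogenization f c q = (q.1 : 𝕜) ^ f.totalDegree * (polyFun f (q.1⁻¹ • q.2) - c) := by
  have hq' : (q.1 : 𝕜) ≠ 0 := RCLike.ofReal_ne_zero.2 hq
  have hf : polyFun f (q.1⁻¹ • q.2) = ∑ k ∈ Finset.range (f.totalDegree + 1),
      polyFun (MvPolynomial.homogeneousComponent k f) (q.1⁻¹ • q.2) := by
    conv_lhs => rw [← MvPolynomial.sum_homogeneousComponent f]
    simp [polyFun]
  rw [homogenization, mul_sub, hf, Finset.mul_sum, mul_comm c]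
  congr 1
  refine Finset.sum_congr rfl fun k hk => ?_
  rw [polyFun_real_smul (MvPolynomial.homogeneousComponent_isHomogeneous k f), ← mul_assoc]
  congr 1
  rw [RCLike.ofReal_inv, inv_pow, pow_sub₀ _ hq' (Nat.lt_succ_iff.1 (Finset.mem_range.1 hk))]

/-- Positive degree is what makes the term `c * r ^ d` vanish at `r = 0`, so all levels share the
same trace at infinity. -/
theorem homogenization_zero {f : MvPolynomial (Fin n) 𝕜} (hf : 0 < f.totalDegree) (c : 𝕜)
    (v : EuclideanSpace 𝕜 (Fin n)) : homogenization f c (0, v) = polyFun (leadingForm f) v := by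
  rw [homogenization, Finset.sum_range_succ, Finset.sum_eq_zero]
  · simp [hf.ne', leadingForm]
  · intro k hk
    have : f.totalDegree - k ≠ 0 := (Nat.sub_pos_of_lt (Finset.mem_range.1 hk)).ne'
    simp [this]

/-- The equation, in the chart at infinity, of the closure of the level `f = c`. -/
noncomputable def equationAtInfinity (f : MvPolynomial (Fin n) 𝕜) (c : 𝕜)
    (q : ℝ × EuclideanSpace 𝕜 (Fin n)) : 𝕜 × ℝ :=
  (homogenization f c q, ‖q.2‖ ^ 2 - 1)

theorem equationAtInfinity_eq_zero_iff {f : MvPolynomial (Fin n) 𝕜} {c : 𝕜}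
    {q : ℝ × EuclideanSpace 𝕜 (Fin n)} :
    equationAtInfinity f c q = 0 ↔ homogenization f c q = 0 ∧ ‖q.2‖ = 1 := by
  rw [equationAtInfinity, Prod.mk_eq_zero, sub_eq_zero, pow_eq_one_iff_of_nonneg (norm_nonneg _) two_ne_zero]

theorem fderiv_equationAtInfinity_apply (f : MvPolynomial (Fin n) 𝕜) (c : 𝕜)
    (x q : ℝ × EuclideanSpace 𝕜 (Fin n)) :
    fderiv ℝ (equationAtInfinity f c) x q = (fderiv ℝ (homogenization f c) x q,
      fderiv ℝ (fun v : EuclideanSpace 𝕜 (Fin n) => ‖v‖ ^ 2) x.2 q.2) := by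
  have h1 := ((contDiff_homogenization f c).differentiable (by simp) x).hasFDerivAt
  have h2 : HasFDerivAt (fun v : EuclideanSpace 𝕜 (Fin n) => ‖v‖ ^ 2) _ x.2 :=
    (((contDiff_norm_sq 𝕜 (n := 1)).differentiable one_ne_zero) x.2).hasFDerivAt
  have h3 := h1.prodMk ((h2.comp x hasFDerivAt_snd).sub_const 1)
  exact congrArg (fun A : _ →L[ℝ] 𝕜 × ℝ => A q) h3.fderiv

theorem isEquationAtInfinity_level {f : MvPolynomial (Fin n) 𝕜} (hf : 0 < f.totalDegree)
    (hgen : level (leadingForm f) 0 ∩ critLocus (leadingForm f) ⊆ {0}) (c : 𝕜) :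
    IsEquationAtInfinity (equationAtInfinity f c) (level f c) where
  contDiff := (contDiff_homogenization f c).prodMk
    (((contDiff_norm_sq 𝕜).comp contDiff_snd).sub contDiff_const)
  norm_eq q hq := (equationAtInfinity_eq_zero_iff.1 hq).2
  mem_iff q hq hn := by
    have hq' : (q.1 : 𝕜) ≠ 0 := RCLike.ofReal_ne_zero.2 hq.ne'
    rw [equationAtInfinity_eq_zero_iff, and_iff_left hn, homogenization_of_ne_zero f c hq.ne',
      mul_eq_zero, or_iff_right (pow_ne_zero _ hq'), sub_eq_zero]
    rfl
  surjective u hu := by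
    obtain ⟨h0, hn⟩ := equationAtInfinity_eq_zero_iff.1 hu
    have hn : ‖u‖ = 1 := hn
    rw [homogenization_zero hf] at h0
    have hu0 : u ≠ 0 := norm_ne_zero_iff.1 (by rw [hn]; exact one_ne_zero)
    have hcrit : u ∉ critLocus (leadingForm f) := fun h => hu0 (hgen ⟨h0, h⟩)
    have hpart : ∀ w, fderiv ℝ (homogenization f c) (0, u) (0, w)
        = fderiv ℝ (polyFun (leadingForm f)) u w := fun w => by
      have h1 := ((contDiff_homogenization f c).differentiable (by simp) (0, u)).hasFDerivAt
      have h2 := h1.comp u (hasFDerivAt_prodMk_right (𝕜 := ℝ) (0 : ℝ) u)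
      have h3 : (homogenization f c ∘ fun v => ((0 : ℝ), v)) = polyFun (leadingForm f) :=
        funext fun v => homogenization_zero hf c v
      rw [h3] at h2
      rw [h2.fderiv]
      rfl
    rintro ⟨z, s⟩
    obtain ⟨w, hw⟩ := surjective_fderiv_polyFun hcrit z
    set N := fderiv ℝ (fun v : EuclideanSpace 𝕜 (Fin n) => ‖v‖ ^ 2) u with hN
    have hNu : N u = 2 := by rw [hN, fderiv_norm_sq_self, hn]; norm_num
    -- The radial correction leaves the first component alone by Euler's identity and sets the
    -- second to `s`, as `N u = 2`.
    refine ⟨w + ((s - N w) / 2) • u, ?_⟩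
    rw [fderiv_equationAtInfinity_apply, hpart]
    refine Prod.ext ?_ ?_
    · change fderiv ℝ (polyFun (leadingForm f)) u _ = z
      have hhom : (leadingForm f).IsHomogeneous f.totalDegree :=
        MvPolynomial.homogeneousComponent_isHomogeneous _ f
      rw [map_add, hw, fderiv_polyFun_real_smul_self hhom h0, add_zero]
    · change N _ = s
      rw [map_add, map_smul, hNu, smul_eq_mul]
      ring

theorem isConicAtInfinity_level {f : MvPolynomial (Fin n) 𝕜} (hf : 0 < f.totalDegree)
    (hgen : level (leadingForm f) 0 ∩ critLocus (leadingForm f) ⊆ {0}) (c : 𝕜) :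
    IsConicAtInfinity (level f c) := by
  refine (isEquationAtInfinity_level hf hgen c).isConicAtInfinity fun u _ q hq => ?_
  rw [fderiv_equationAtInfinity_apply] at hq
  exact (Prod.mk_eq_zero.1 hq).2

theorem isLNE_connectedComponentIn_level {f : MvPolynomial (Fin n) 𝕜} (hf : 0 < f.totalDegree)
    (hgen : level (leadingForm f) 0 ∩ critLocus (leadingForm f) ⊆ {0}) {c : 𝕜}
    (hreg : Disjoint (level f c) (critLocus f)) (x : EuclideanSpace 𝕜 (Fin n)) :
    IsLNE (connectedComponentIn (level f c) x) := by
  have hlevel : level f c = {x | polyFun f x - c = 0} := by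
    ext x; exact sub_eq_zero.symm
  have hG := isEquationAtInfinity_level hf hgen c
  rw [hlevel] at hG ⊢
  refine isLNE_connectedComponentIn_of_regular ((contDiff_polyFun f).sub contDiff_const)
    (fun a ha => ?_) hG x
  rw [fderiv_sub_const]
  exact surjective_fderiv_polyFun (disjoint_left.1 hreg (hlevel ▸ ha))

end Homogenization

end ConicLNE

namespace ConicLNE

/-! ### Leading forms, irreducibility and the Nullstellensatz -/

section Irreducibility

/-- Among pairs of degrees bounded by the two total degrees, only the top pair reaches their sum. -/
theorem homogeneousComponent_add_mul {σ R : Type*} [CommSemiring R] (a b : MvPolynomial σ R) :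
    MvPolynomial.homogeneousComponent (a.totalDegree + b.totalDegree) (a * b) =
      MvPolynomial.homogeneousComponent a.totalDegree a *
        MvPolynomial.homogeneousComponent b.totalDegree b := by
  have hhom : ∀ i j, (MvPolynomial.homogeneousComponent i a *
      MvPolynomial.homogeneousComponent j b).IsHomogeneous (i + j) := fun i j =>
    (MvPolynomial.homogeneousComponent_isHomogeneous i a).mul
      (MvPolynomial.homogeneousComponent_isHomogeneous j b)
  have hab : a * b = ∑ i ∈ Finset.range (a.totalDegree + 1),
      ∑ j ∈ Finset.range (b.totalDegree + 1),
        MvPolynomial.homogeneousComponent i a * MvPolynomial.homogeneousComponent j b := by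
    rw [← Finset.sum_mul_sum, MvPolynomial.sum_homogeneousComponent,
      MvPolynomial.sum_homogeneousComponent]
  have hcomp : ∀ i j, MvPolynomial.homogeneousComponent (a.totalDegree + b.totalDegree)
      (MvPolynomial.homogeneousComponent i a * MvPolynomial.homogeneousComponent j b) =
      if a.totalDegree + b.totalDegree = i + j then
        MvPolynomial.homogeneousComponent i a * MvPolynomial.homogeneousComponent j b else 0 :=
    fun i j => MvPolynomial.homogeneousComponent_of_mem (hhom i j)
  conv_lhs => rw [hab]
  simp only [map_sum, hcomp]
  rw [Finset.sum_eq_single a.totalDegree, Finset.sum_eq_single b.totalDegree, if_pos rfl]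
  · exact fun j _ hj => if_neg (by omega)
  · simp
  · intro i hi hne
    rw [Finset.mem_range] at hi
    refine Finset.sum_eq_zero fun j hj => if_neg ?_
    rw [Finset.mem_range] at hj
    omega
  · simp

variable {𝕜 : Type*} [RCLike 𝕜] {n : ℕ}

theorem leadingForm_mul {a b : MvPolynomial (Fin n) 𝕜} (ha : a ≠ 0) (hb : b ≠ 0) :
    leadingForm (a * b) = leadingForm a * leadingForm b := by
  rw [leadingForm, MvPolynomial.totalDegree_mul_of_isDomain ha hb, homogeneousComponent_add_mul]
  rfl

theorem leadingForm_sub_C {f : MvPolynomial (Fin n) 𝕜} (hf : 0 < f.totalDegree) (c : 𝕜) :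
    leadingForm (f - MvPolynomial.C c) = leadingForm f := by
  have hd : (f - MvPolynomial.C c).totalDegree = f.totalDegree := by
    rw [sub_eq_add_neg, ← MvPolynomial.C_neg]
    exact MvPolynomial.totalDegree_add_eq_left_of_totalDegree_lt (by simpa using hf)
  rw [leadingForm, hd, map_sub, leadingForm, sub_eq_self]
  exact MvPolynomial.homogeneousComponent_eq_zero _ _ (by simpa using hf)

/-- A unit leading form has degree zero; then `a` is constant and equals its leading form. -/
theorem isUnit_of_isUnit_leadingForm {a : MvPolynomial (Fin n) 𝕜} (h : IsUnit (leadingForm a)) :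
    IsUnit a := by
  have h0 : (leadingForm a).totalDegree = 0 := (MvPolynomial.isUnit_iff_totalDegree_of_isReduced.1 h).2
  have h1 : (leadingForm a).totalDegree = a.totalDegree :=
    (MvPolynomial.homogeneousComponent_isHomogeneous _ a).totalDegree h.ne_zero
  rw [h1] at h0
  rwa [leadingForm, h0, MvPolynomial.homogeneousComponent_zero,
    ← MvPolynomial.totalDegree_eq_zero_iff_eq_C.1 h0] at h

theorem irreducible_of_irreducible_leadingForm {p : MvPolynomial (Fin n) 𝕜}
    (hp : 0 < p.totalDegree) (h : Irreducible (leadingForm p)) : Irreducible p := by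
  refine ⟨fun hu => ?_, fun a b hab => ?_⟩
  · exact hp.ne' (MvPolynomial.isUnit_iff_totalDegree_of_isReduced.1 hu).2
  · have hp0 : p ≠ 0 := by rintro rfl; simp at hp
    have ha : a ≠ 0 := by rintro rfl; simp [hp0] at hab
    have hb : b ≠ 0 := by rintro rfl; simp [hp0] at hab
    rw [hab, leadingForm_mul ha hb] at h
    exact (h.isUnit_or_isUnit rfl).imp isUnit_of_isUnit_leadingForm isUnit_of_isUnit_leadingForm

theorem irreducible_sub_C {f : MvPolynomial (Fin n) 𝕜} (hf : 0 < f.totalDegree)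
    (h : Irreducible (leadingForm f)) (c : 𝕜) : Irreducible (f - MvPolynomial.C c) := by
  have hl := leadingForm_sub_C hf c
  refine irreducible_of_irreducible_leadingForm ?_ (hl ▸ h)
  rw [sub_eq_add_neg, ← MvPolynomial.C_neg,
    MvPolynomial.totalDegree_add_eq_left_of_totalDegree_lt (by simpa using hf)]
  exact hf

open MvPolynomial in
/-- A polynomial vanishing on the zero set of a complex irreducible polynomial is a multiple
of it. -/
theorem dvd_of_forall_eval_eq_zero {p g : MvPolynomial (Fin n) ℂ} (hp : Irreducible p)
    (h : ∀ x : Fin n → ℂ, eval x p = 0 → eval x g = 0) : p ∣ g := by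
  have hprime : (Ideal.span {p}).IsPrime := (Ideal.span_singleton_prime hp.ne_zero).2 hp.prime
  have hg : g ∈ vanishingIdeal ℂ (zeroLocus ℂ (Ideal.span {p})) := fun x hx => by
    rw [aeval_eq_eval]
    refine h x ?_
    have := hx p (Ideal.mem_span_singleton_self p)
    rwa [aeval_eq_eval] at this
  -- Nullstellensatz; the ideal is its own radical because an irreducible element of this factorial
  -- ring is prime.
  rw [vanishingIdeal_zeroLocus_eq_radical, hprime.radical] at hg
  exact Ideal.mem_span_singleton.1 hg

theorem isIrreducibleAlgebraicSet_level {f : MvPolynomial (Fin n) ℂ} {c : ℂ}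
    (hirr : Irreducible (f - MvPolynomial.C c)) : IsIrreducibleAlgebraicSet (level f c) := by
  set p := f - MvPolynomial.C c with hp
  have hlevel : level f c = {x | MvPolynomial.eval (fun i => x i) p = 0} := by
    ext x; simp [level, hp, sub_eq_zero]
  have hmem : ∀ x : Fin n → ℂ, MvPolynomial.eval x p = 0 → WithLp.toLp 2 x ∈ level f c :=
    fun x hx => by rw [hlevel]; exact hx
  refine ⟨⟨{p}, by simpa using hlevel⟩, ?_, ?_⟩
  · by_contra hne
    rw [Set.not_nonempty_iff_eq_empty] at hne
    -- On an empty zero set even 1 vanishes, so `p` would divide 1.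
    refine hirr.not_isUnit (isUnit_of_dvd_one (dvd_of_forall_eval_eq_zero hirr fun x hx => ?_))
    exact absurd (hmem x hx) (hne ▸ Set.notMem_empty _)
  · rintro Z₁ Z₂ ⟨S₁, rfl⟩ ⟨S₂, rfl⟩ hZ
    by_contra! hne
    have hout : ∀ S : Set (MvPolynomial (Fin n) ℂ),
        {x : EuclideanSpace ℂ (Fin n) | ∀ p ∈ S, MvPolynomial.eval (fun i => x i) p = 0}
          ⊆ level f c →
        level f c ≠ {x | ∀ p ∈ S, MvPolynomial.eval (fun i => x i) p = 0} →
        ∃ g ∈ S, ¬ p ∣ g := by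
      intro S hS hneS
      by_contra! hall
      refine hneS (Set.Subset.antisymm (fun x hx g hg => ?_) hS)
      obtain ⟨k, rfl⟩ := hall g hg
      rw [hlevel] at hx
      rw [map_mul, show MvPolynomial.eval (fun i => x i) p = 0 from hx, zero_mul]
    obtain ⟨g₁, hg₁, hd₁⟩ := hout S₁ (hZ ▸ Set.subset_union_left) hne.1
    obtain ⟨g₂, hg₂, hd₂⟩ := hout S₂ (hZ ▸ Set.subset_union_right) hne.2
    -- Each factor vanishes on one of the two pieces, so the product vanishes on the whole level,
    -- against primality of `p`.
    have hdvd : p ∣ g₁ * g₂ := dvd_of_forall_eval_eq_zero hirr fun x hx => by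
      have := hmem x hx
      rw [hZ] at this
      rw [map_mul]
      rcases this with h | h
      · rw [show MvPolynomial.eval x g₁ = 0 from h g₁ hg₁, zero_mul]
      · rw [show MvPolynomial.eval x g₂ = 0 from h g₂ hg₂, mul_zero]
    exact (hirr.prime.dvd_or_dvd hdvd).elim hd₁ hd₂

end Irreducibility

end ConicLNE

theorem corollary5p3 (n : ℕ) :
    (∀ (𝕜 : Type) [RCLike 𝕜] (f : MvPolynomial (Fin n) 𝕜), 0 < f.totalDegree →
      ConicLNE.IsGenericForm (ConicLNE.leadingForm f) →
      ∀ c : 𝕜, (ConicLNE.level f c).Nonempty →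
        Disjoint (ConicLNE.level f c) (ConicLNE.critLocus f) →
        ConicLNE.IsConicAtInfinity (ConicLNE.level f c) ∧
        ∀ x ∈ ConicLNE.level f c,
          ConicLNE.IsLNE (connectedComponentIn (ConicLNE.level f c) x)) ∧
    (∀ f : MvPolynomial (Fin n) ℂ, 0 < f.totalDegree →
      ConicLNE.IsGenericForm (ConicLNE.leadingForm f) →
      ∀ c : ℂ, ConicLNE.IsIrreducibleAlgebraicSet (ConicLNE.level f c)) := by
  refine ⟨fun 𝕜 _ f hf hgen c _ hreg => ⟨?_, fun x _ => ?_⟩, fun f hf hgen c => ?_⟩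
  · exact ConicLNE.isConicAtInfinity_level hf hgen.2 c
  · exact ConicLNE.isLNE_connectedComponentIn_level hf hgen.2 hreg x
  · exact ConicLNE.isIrreducibleAlgebraicSet_level (ConicLNE.irreducible_sub_C hf hgen.1 c)
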